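/- Let $\mathcal U\subset\mathbb R^{2\times2}_{sym}$ be a finite coplanar set, that is, there are $0\ne Q\in\mathbb R^{2\times2}_{sym}$ and $\delta\in\mathbb R$ with $\langle Q,U\rangle=\delta$ (Frobenius inner product) for all $U\in\mathcal U$. If $\mathcal U$ is a basic configuration, then $L^e(\mathcal U)=Q^e(\mathcal U)$. Here the following definitions are used. Two matrices $A,B\in\mathbb R^{2\times2}_{sym}$ are *compatible* if $\operatorname{rank}(A-B+S)\le1$ for some skew-symmetric $S$, *incompatible* otherwise, and *rank-one compatible* if $\operatorname{rank}(A-B)\le1$. $L^e(\mathcal U)=\bigcup_{i\ge0}L^{e,i}(\mathcal U)$, where $L^{e,0}(\mathcal U)=\mathcal U$ and $L^{e,i+1}(\mathcal U)$ is the set of all $\lambda A+(1-\lambda)B$ with $\lambda\in[0,1]$ and $A,B\in L^{e,i}(\mathcal U)$ compatible ($A=B$ allowed). Write $e(M)=(M+M^T)/2$. A function $f:\mathbb R^{2\times2}_{sym}\to\mathbb R$ is *symmetric quasiconvex* if $g=f\circ e:\mathbb R^{2\times2}\to\mathbb R$ is quasiconvex, that is, $g$ is Borel measurable, locally bounded,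 and $g(M)\le\frac1{|\Omega|}\int_\Omega g(M+D\phi)\,dx$ for all $M\in\mathbb R^{2\times 2}$, all nonempty bounded open $\Omega\subset\mathbb R^2$ and all $\phi\in C_c^\infty(\Omega;\mathbb R^2)$. The symmetric quasiconvex hull $Q^e(\mathcal U)$ is the set of all $A\in\mathbb R^{2\times2}_{sym}$ such that $f(A)\le\sup_{B\in\mathcal U}f(B)$ for every symmetric quasiconvex $f$. A *three-well basic block* (flag) is a set of three wells among whose three pairs one is compatible but not rank-one compatible, one is rank-one compatible, and one is incompatible. A *four-well basic block* (cross) is a set of four wells containing two different rank-one compatible pairs $\{V_1,V_2\}\ne\{W_1,W_2\}$ (with $V_1\neq V_2$, $W_1\ne W_2$) such that the union $D$ of the segments $[V_1,V_2]$ and $[W_1,W_2]$ is connected and contains all four wells. The set $\mathcal U$ is a *basic configuration* if no three distinct wells of $\mathcal U$ are collinear and $\mathcal U=\mathcal U_1\cup\dots\cup\mathcal U_n$ for some $n\ge1$ and basic blocks $\mathcal U_1,\dots,\mathcal U_n$ such that for every $i<n$ the intersection $\mathcal U_i\cap\mathcal U_{i+1}$ consists of exactly two wells, which are compatible but not rank-one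 compatible. -/

import Mathlib

open MeasureTheory Set

namespace Wells

/-- Real `2 × 2` matrices. -/
abbrev Mat : Type := Matrix (Fin 2) (Fin 2) ℝ

/-! ### Compatibility -/

/-- `A` and `B` are compatible if `rank (A - B + S) ≤ 1` for some skew-symmetric `S`. -/
def Compatible (A B : Mat) : Prop :=
  ∃ S : Mat, S.transpose = -S ∧ (A - B + S).rank ≤ 1

/-- `A` and `B` are rank-one compatible if `rank (A - B) ≤ 1`. -/
def RankOneCompatible (A B : Mat) : Prop :=
  (A - B).rank ≤ 1

/-! ### The symmetric lamination convex hull -/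

/-- The compatible lamination hull of order `i`. -/
def lamHullStep (U : Set Mat) : ℕ → Set Mat
  | 0 => U
  | i + 1 => {M | ∃ A ∈ lamHullStep U i, ∃ B ∈ lamHullStep U i, Compatible A B ∧
      ∃ t : ℝ, 0 ≤ t ∧ t ≤ 1 ∧ M = t • A + (1 - t) • B}

/-- The symmetric lamination convex hull `L^e(U)`. -/
def symLaminationHull (U : Set Mat) : Set Mat :=
  ⋃ i : ℕ, lamHullStep U i

/-! ### The symmetric quasiconvex hull -/

/-- The symmetric part `e(M) = (M + Mᵀ) / 2`. -/
noncomputable def symPart (M : Mat) : Mat :=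
  (1 / 2 : ℝ) • (M + M.transpose)

/-- The Jacobian matrix of `φ` at `x`: the `(i, j)` entry is `∂φ_i/∂x_j`. -/
noncomputable def jacobian (φ : (Fin 2 → ℝ) → (Fin 2 → ℝ)) (x : Fin 2 → ℝ) : Mat :=
  Matrix.of fun i j => fderiv ℝ φ x (Pi.single j 1) i

/-- Quasiconvexity of a function on `2 × 2` matrices: Borel measurable, locally bounded, and
`f M ≤ |Ω|⁻¹ ∫_Ω f (M + Dφ)` for all test fields `φ ∈ C_c^∞(Ω; ℝ²)` on bounded open sets `Ω`.
(Neither the norm chosen on the plane nor the choice of `Ω` matters; the integrand is bounded and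
measurable, so the mean value is a genuine one.) -/
def IsQuasiconvex (f : Mat → ℝ) : Prop :=
  Measurable[borel Mat] f ∧
  (∀ K : Set Mat, IsCompact K → ∃ C : ℝ, ∀ M ∈ K, |f M| ≤ C) ∧
  ∀ Ω : Set (Fin 2 → ℝ), IsOpen Ω → Ω.Nonempty → Bornology.IsBounded Ω →
    ∀ φ : (Fin 2 → ℝ) → (Fin 2 → ℝ),
      ContDiff ℝ (⊤ : ℕ∞) φ → HasCompactSupport φ → tsupport φ ⊆ Ω →
      ∀ M : Mat, f M ≤ ⨍ x in Ω, f (M + jacobian φ x)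

/-- `f` is symmetric quasiconvex if `f ∘ e` is quasiconvex. Only the restriction of `f` to the
symmetric matrices enters; its values elsewhere are irrelevant. -/
def IsSymQuasiconvex (f : Mat → ℝ) : Prop :=
  IsQuasiconvex fun M => f (symPart M)

/-- The symmetric quasiconvex hull `Q^e(U)`: the symmetric matrices that no symmetric quasiconvex
function separates from `U`. -/
def symQuasiconvexHull (U : Set Mat) : Set Mat :=
  {A | A.IsSymm ∧ ∀ f : Mat → ℝ, IsSymQuasiconvex f → f A ≤ sSup (f '' U)}

/-! ### Coplanar sets and basic configurations -/

/-- `U` lies in a plane `{M | ⟨Q, M⟩ = δ}` of the space of symmetric matrices, for the Frobenius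
inner product. -/
def IsCoplanar (U : Set Mat) : Prop :=
  ∃ (Q : Mat) (δ : ℝ), Q.IsSymm ∧ Q ≠ 0 ∧ ∀ M ∈ U, ∑ i, ∑ j, Q i j * M i j = δ

/-- Three-well basic block (flag): of its three pairs, one is compatible but not rank-one
compatible, one is rank-one compatible, and one is incompatible. The three wells are then
automatically distinct. -/
def IsFlagBlock (B : Set Mat) : Prop :=
  ∃ X Y Z : Mat, B = {X, Y, Z} ∧
    (Compatible X Y ∧ ¬ RankOneCompatible X Y) ∧
    RankOneCompatible X Z ∧
    ¬ Compatible Y Z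

/-- Four-well basic block (cross): four wells, among them two different rank-one compatible pairs
`{V₁, V₂}` and `{W₁, W₂}`, such that the union of the two segments they span is connected and
contains all four wells. -/
def IsCrossBlock (B : Set Mat) : Prop :=
  B.ncard = 4 ∧ ∃ V₁ V₂ W₁ W₂ : Mat,
    V₁ ∈ B ∧ V₂ ∈ B ∧ W₁ ∈ B ∧ W₂ ∈ B ∧
    V₁ ≠ V₂ ∧ W₁ ≠ W₂ ∧ ({V₁, V₂} : Set Mat) ≠ {W₁, W₂} ∧
    RankOneCompatible V₁ V₂ ∧ RankOneCompatible W₁ W₂ ∧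
    IsConnected (segment ℝ V₁ V₂ ∪ segment ℝ W₁ W₂) ∧
    B ⊆ segment ℝ V₁ V₂ ∪ segment ℝ W₁ W₂

/-- Basic blocks. -/
def IsBasicBlock (B : Set Mat) : Prop :=
  IsFlagBlock B ∨ IsCrossBlock B

/-- Basic configurations: no three wells are collinear, and the set is the union of a chain
`B 0, …, B n` of basic blocks, any two consecutive ones having exactly two wells in common, which
are compatible but not rank-one compatible. -/
def IsBasicConfiguration (U : Set Mat) : Prop :=
  (∀ X ∈ U, ∀ Y ∈ U, ∀ Z ∈ U, X ≠ Y → Y ≠ Z → X ≠ Z → ¬ Collinear ℝ ({X, Y, Z} : Set Mat)) ∧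
  ∃ (n : ℕ) (B : ℕ → Set Mat),
    U = ⋃ i ∈ Finset.range (n + 1), B i ∧
    (∀ i ≤ n, IsBasicBlock (B i)) ∧
    ∀ i < n, ∃ V W : Mat, B i ∩ B (i + 1) = {V, W} ∧
      Compatible V W ∧ ¬ RankOneCompatible V W

end Wells

namespace Wells

/-! ### Integrals of minors of gradients -/

section Minors

variable {E : Type*} [NormedAddCommGroup E] [NormedSpace ℝ E]

/-! The inclusion of the lamination hull in the quasiconvex hull rests on
`IsQuasiconvex.le_max_of_vecMulVec`: along a rank-one segment a quasiconvex function stays below the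
larger of its endpoint values, as a single laminate on a very long box shows. A skew shift carries
this over to compatible symmetric matrices.

For the converse it suffices to test with `-c det + affine`, `c ≥ 0`
(`isSymQuasiconvex_neg_det_add_linear`). Affine functions keep the hull in the plane `⟨Q, ·⟩ = δ`. A
basic block forces `det Q < 0` (`det_neg_of_isBasicBlock`), so this plane has coordinates in which
the determinant of a difference is `k` times the product of the coordinate differences. Compatible
then means that this product is nonpositive, and rank-one compatible means horizontal or vertical.

In these coordinates a basic configuration is a staircase (`staircase_preimage`): a chain of boxes
with corners increasing in both coordinates, where the wells are the ends of the falling diagonals,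
plus possibly one extra well at either end of the chain. A block adds to its compatible pair only
wells that share a coordinate with one member and lie beyond the other, and having at most two wells
on each axis-parallel line leaves no other place for them.

For a staircase both hulls can be read off. Every well is comparable with every corner, so `(z₁ -
xⱼ)(z₂ - yⱼ) ≥ 0` passes to the hull and confines it to the boxes and to end segments. Inside a box,
the triangle on one side of the diagonal is filled by laminates when its right-angled corner is
reached from neighbouring wells; otherwise the diagonal spans a supporting line and that side
contains no hull point (`IsStaircase.mem_of_inPolyHull`). -/

theorem hasCompactSupport_fderiv_apply {u : E → ℝ} (hc : HasCompactSupport u) (v : E) :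
    HasCompactSupport fun x => fderiv ℝ u x v :=
  hc.fderiv_apply (𝕜 := ℝ) v

theorem contDiff_fderiv_apply {u : E → ℝ} (hu : ContDiff ℝ (⊤ : ℕ∞) u) (v : E) :
    ContDiff ℝ (⊤ : ℕ∞) fun x => fderiv ℝ u x v :=
  (hu.fderiv_right (m := (⊤ : ℕ∞)) (by simp)).clm_apply contDiff_const

variable [MeasurableSpace E] [BorelSpace E] [FiniteDimensional ℝ E] {μ : Measure E}
  [μ.IsAddHaarMeasure]

theorem integral_fderiv_apply_eq_zero {u : E → ℝ} (hu : ContDiff ℝ (⊤ : ℕ∞) u)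
    (hc : HasCompactSupport u) (v : E) : ∫ x, fderiv ℝ u x v ∂μ = 0 := by
  have h1 := (contDiff_fderiv_apply hu v).continuous.integrable_of_hasCompactSupport (μ := μ)
    (hasCompactSupport_fderiv_apply hc v)
  have h2 := hu.continuous.integrable_of_hasCompactSupport (μ := μ) hc
  have := integral_mul_fderiv_eq_neg_fderiv_mul_of_integrable (𝕜 := ℝ) (μ := μ)
    (f := fun _ : E => (1 : ℝ)) (g := u) (v := v) (by simp) (by simpa using h1) (by simpa using h2)
    (fun x _ => differentiableAt_const _)
    (fun x _ => (hu.differentiable (by simp)).differentiableAt)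
  simpa using this

/-- Integrate by parts to put both derivatives on `w`, where their order is irrelevant. This is what
makes the determinant a null Lagrangian. -/
theorem integral_fderiv_mul_fderiv_comm {u w : E → ℝ} (hu : ContDiff ℝ (⊤ : ℕ∞) u)
    (hw : ContDiff ℝ (⊤ : ℕ∞) w) (hc : HasCompactSupport u) (v v' : E) :
    ∫ x, fderiv ℝ u x v * fderiv ℝ w x v' ∂μ = ∫ x, fderiv ℝ u x v' * fderiv ℝ w x v ∂μ := by
  have key : ∀ a b : E, ∫ x, fderiv ℝ u x a * fderiv ℝ w x b ∂μ
      = - ∫ x, u x * fderiv ℝ (fun y => fderiv ℝ w y b) x a ∂μ := by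
    intro a b
    have hwb := contDiff_fderiv_apply hw b
    have h := integral_mul_fderiv_eq_neg_fderiv_mul_of_integrable (𝕜 := ℝ) (μ := μ) (f := u)
      (g := fun y => fderiv ℝ w y b) (v := a)
      (((contDiff_fderiv_apply hu a).continuous.mul
        hwb.continuous).integrable_of_hasCompactSupport
        (hasCompactSupport_fderiv_apply hc a).mul_right)
      ((hu.continuous.mul
        (contDiff_fderiv_apply hwb a).continuous).integrable_of_hasCompactSupport hc.mul_right)
      ((hu.continuous.mul hwb.continuous).integrable_of_hasCompactSupport hc.mul_right)
      (fun x _ => (hu.differentiable (by simp)).differentiableAt)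
      (fun x _ => (hwb.differentiable (by simp)).differentiableAt)
    rw [h, neg_neg]
  rw [key, key]
  congr 2
  ext x
  congr 1
  have hsymm : IsSymmSndFDerivAt ℝ w x :=
    hw.contDiffAt.isSymmSndFDerivAt (by
      rw [minSmoothness_of_isRCLikeNormedField]
      exact WithTop.coe_le_coe.2 (le_top : (2 : ℕ∞) ≤ ⊤))
  have hd : DifferentiableAt ℝ (fderiv ℝ w) x :=
    ((hw.fderiv_right (m := (⊤ : ℕ∞)) (by simp)).differentiable (by simp)).differentiableAt
  have e : ∀ a b : E, fderiv ℝ (fun y => fderiv ℝ w y b) x a = fderiv ℝ (fderiv ℝ w) x a b := by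
    intro a b
    rw [fderiv_clm_apply hd (differentiableAt_const b)]
    simp
  rw [e, e, hsymm.eq]

end Minors

/-! ### Polyconvex functions of the symmetric part -/

theorem jacobian_apply_eq {φ : (Fin 2 → ℝ) → (Fin 2 → ℝ)} (hφ : Differentiable ℝ φ)
    (x : Fin 2 → ℝ) (i j : Fin 2) :
    jacobian φ x i j = fderiv ℝ (fun y => φ y i) x (Pi.single j 1) := by
  simp only [jacobian, Matrix.of_apply]
  rw [fderiv_apply (hφ x) i]
  rfl

theorem continuous_jacobian {φ : (Fin 2 → ℝ) → (Fin 2 → ℝ)} (hφ : ContDiff ℝ (⊤ : ℕ∞) φ) :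
    Continuous (jacobian φ) := by
  refine continuous_matrix fun i j => ?_
  simp only [jacobian_apply_eq (hφ.differentiable (by simp))]
  exact (contDiff_fderiv_apply (contDiff_pi.1 hφ i) _).continuous

theorem jacobian_eq_zero_of_notMem_tsupport {φ : (Fin 2 → ℝ) → (Fin 2 → ℝ)} {x : Fin 2 → ℝ}
    (hx : x ∉ tsupport φ) : jacobian φ x = 0 := by
  have h := image_eq_zero_of_notMem_tsupport fun h => hx (tsupport_fderiv_subset ℝ h)
  ext i j
  simp [jacobian, h]

theorem hasCompactSupport_component {φ : (Fin 2 → ℝ) → (Fin 2 → ℝ)} (hc : HasCompactSupport φ)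
    (i : Fin 2) : HasCompactSupport fun y => φ y i :=
  hc.comp_left (g := fun v : Fin 2 → ℝ => v i) rfl

theorem integral_jacobian_apply {φ : (Fin 2 → ℝ) → (Fin 2 → ℝ)} (hφ : ContDiff ℝ (⊤ : ℕ∞) φ)
    (hc : HasCompactSupport φ) (i j : Fin 2) : ∫ x, jacobian φ x i j = 0 := by
  simp only [jacobian_apply_eq (hφ.differentiable (by simp))]
  exact integral_fderiv_apply_eq_zero (contDiff_pi.1 hφ i) (hasCompactSupport_component hc i) _

theorem hasCompactSupport_jacobian_apply {φ : (Fin 2 → ℝ) → (Fin 2 → ℝ)}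
    (hc : HasCompactSupport φ) (i j : Fin 2) : HasCompactSupport fun x => jacobian φ x i j :=
  HasCompactSupport.intro hc fun x hx => by
    rw [jacobian_eq_zero_of_notMem_tsupport hx]; rfl

theorem continuous_jacobian_apply {φ : (Fin 2 → ℝ) → (Fin 2 → ℝ)} (hφ : ContDiff ℝ (⊤ : ℕ∞) φ)
    (i j : Fin 2) : Continuous fun x => jacobian φ x i j :=
  (continuous_jacobian hφ).matrix_elem i j

theorem integrable_jacobian_apply {φ : (Fin 2 → ℝ) → (Fin 2 → ℝ)} (hφ : ContDiff ℝ (⊤ : ℕ∞) φ)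
    (hc : HasCompactSupport φ) (i j : Fin 2) : Integrable fun x => jacobian φ x i j :=
  (continuous_jacobian_apply hφ i j).integrable_of_hasCompactSupport
    (hasCompactSupport_jacobian_apply hc i j)

theorem integrable_jacobian_apply_mul {φ : (Fin 2 → ℝ) → (Fin 2 → ℝ)}
    (hφ : ContDiff ℝ (⊤ : ℕ∞) φ) (hc : HasCompactSupport φ) (i j k l : Fin 2) :
    Integrable fun x => jacobian φ x i j * jacobian φ x k l :=
  ((continuous_jacobian_apply hφ i j).mul
    (continuous_jacobian_apply hφ k l)).integrable_of_hasCompactSupport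
    (hasCompactSupport_jacobian_apply hc i j).mul_right

theorem integral_det_jacobian {φ : (Fin 2 → ℝ) → (Fin 2 → ℝ)} (hφ : ContDiff ℝ (⊤ : ℕ∞) φ)
    (hc : HasCompactSupport φ) : ∫ x, (jacobian φ x).det = 0 := by
  simp only [Matrix.det_fin_two]
  rw [integral_sub (integrable_jacobian_apply_mul hφ hc _ _ _ _)
    (integrable_jacobian_apply_mul hφ hc _ _ _ _), sub_eq_zero]
  simp only [jacobian_apply_eq (hφ.differentiable (by simp))]
  exact integral_fderiv_mul_fderiv_comm (contDiff_pi.1 hφ 0) (contDiff_pi.1 hφ 1)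
    (hasCompactSupport_component hc 0) _ _

theorem continuous_symPart : Continuous symPart := by
  unfold symPart
  fun_prop

/-- A function of a symmetric matrix that is affine in the matrix and nonincreasing affine in its
determinant is symmetric quasiconvex. -/
theorem isSymQuasiconvex_neg_det_add_linear {c : ℝ} (hc : 0 ≤ c) (α β γ δ : ℝ) :
    IsSymQuasiconvex fun A => -c * A.det + (α * A 0 0 + β * A 0 1 + γ * A 1 1) + δ := by
  have hcont : Continuous fun A : Mat =>
      -c * A.det + (α * A 0 0 + β * A 0 1 + γ * A 1 1) + δ := by
    have h : ∀ i j, Continuous fun A : Mat => A i j := fun i j => continuous_id.matrix_elem i j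
    have hdet : Continuous fun A : Mat => A.det := continuous_id.matrix_det
    have h0 := h 0 0
    have h1 := h 0 1
    have h2 := h 1 1
    fun_prop
  have hcont' := hcont.comp continuous_symPart
  refine ⟨?_, fun K hK => ?_, ?_⟩
  · exact hcont'.borel_measurable
  · obtain ⟨C, hC⟩ := hK.exists_bound_of_continuousOn hcont'.continuousOn
    exact ⟨C, fun M hM => hC M hM⟩
  · intro Ω hΩ hne hbd φ hφ hcs hsupp M
    set m := symPart M with hm
    have hvol : volume Ω ≠ ⊤ := hbd.measure_lt_top.ne
    have hpos : 0 < volume.real Ω :=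
      ENNReal.toReal_pos (hΩ.measure_pos volume hne).ne' hvol
    -- The coefficients of the first-order part in `J`: the given linear form plus the derivative of
    -- `-c det` at `m`.
    set p : ℝ := α - c * m 1 1 with hp
    set q : ℝ := β / 2 + c * m 0 1 with hq
    set s : ℝ := γ - c * m 0 0 with hs
    let J := jacobian φ
    have hI := fun i j => integrable_jacobian_apply hφ hcs i j
    have hIm := fun i j k l => integrable_jacobian_apply_mul hφ hcs i j k l
    let r : (Fin 2 → ℝ) → ℝ := fun x => p * J x 0 0 + q * J x 0 1 + q * J x 1 0 + s * J x 1 1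
      - c * (J x).det
    have hdetI : Integrable fun x => (J x).det := by
      simp only [Matrix.det_fin_two]
      exact (hIm _ _ _ _).sub (hIm _ _ _ _)
    have hr : Integrable r :=
      (((((hI 0 0).const_mul p).add ((hI 0 1).const_mul q)).add ((hI 1 0).const_mul q)).add
        ((hI 1 1).const_mul s)).sub (hdetI.const_mul c)
    have hr0 : ∫ x, r x = 0 := by
      have e1 : Integrable fun x => p * J x 0 0 + q * J x 0 1 := ((hI 0 0).const_mul p).add ((hI 0 1).const_mul q)
      have e2 : Integrable fun x => p * J x 0 0 + q * J x 0 1 + q * J x 1 0 :=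
        e1.add ((hI 1 0).const_mul q)
      have e3 : Integrable fun x => p * J x 0 0 + q * J x 0 1 + q * J x 1 0 + s * J x 1 1 :=
        e2.add ((hI 1 1).const_mul s)
      rw [integral_sub e3 (hdetI.const_mul c), integral_add e2 ((hI 1 1).const_mul s),
        integral_add e1 ((hI 1 0).const_mul q),
        integral_add ((hI 0 0).const_mul p) ((hI 0 1).const_mul q)]
      simp only [integral_const_mul]
      have hdet0 : ∫ x, (J x).det = 0 := integral_det_jacobian hφ hcs
      rw [hdet0]
      simp [integral_jacobian_apply hφ hcs]
    have hrΩ : ∫ x in Ω, r x = 0 := by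
      rw [setIntegral_eq_integral_of_forall_compl_eq_zero, hr0]
      intro x hx
      have : J x = 0 := jacobian_eq_zero_of_notMem_tsupport fun h => hx (hsupp h)
      simp [r, this, Matrix.det_fin_two]
    -- Since `det (e J) = det J - (J₀₁ - J₁₀)² / 4`, the integrand is a constant, plus the null
    -- Lagrangian `r`, plus this nonnegative square.
    let w : (Fin 2 → ℝ) → ℝ := fun x => c / 4 * ((J x 0 1 - J x 1 0) * (J x 0 1 - J x 1 0))
    have hw : Integrable w := by
      have : w = fun x => c / 4 * (J x 0 1 * J x 0 1 - 2 * (J x 0 1 * J x 1 0)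
          + J x 1 0 * J x 1 0) := by
        ext x; simp only [w]; ring
      rw [this]
      exact (((hIm _ _ _ _).sub ((hIm _ _ _ _).const_mul 2)).add (hIm _ _ _ _)).const_mul _
    let k : ℝ := -c * m.det + (α * m 0 0 + β * m 0 1 + γ * m 1 1) + δ
    have hm01 : m 1 0 = m 0 1 := by
      simp [hm, symPart, add_comm]
    have hdecomp : (fun x => -c * (symPart (M + J x)).det + (α * symPart (M + J x) 0 0
        + β * symPart (M + J x) 0 1 + γ * symPart (M + J x) 1 1) + δ)
        = fun x => (k + r x) + w x := by
      ext x
      have e : symPart (M + J x) = m + symPart (J x) := by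
        simp only [hm, symPart, Matrix.transpose_add, ← smul_add]
        congr 1; abel
      have e00 : symPart (J x) 0 0 = J x 0 0 := by simp [symPart]; ring
      have e11 : symPart (J x) 1 1 = J x 1 1 := by simp [symPart]; ring
      have e01 : symPart (J x) 0 1 = (J x 0 1 + J x 1 0) / 2 := by simp [symPart]; ring
      have e10 : symPart (J x) 1 0 = (J x 0 1 + J x 1 0) / 2 := by simp [symPart]; ring
      rw [e]
      simp only [k, r, w, hp, hq, hs, Matrix.det_fin_two, Matrix.add_apply, e00, e11, e01, e10,
        hm01]
      ring
    change k ≤ ⨍ x in Ω, (fun x => -c * (symPart (M + J x)).det + (α * symPart (M + J x) 0 0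
        + β * symPart (M + J x) 0 1 + γ * symPart (M + J x) 1 1) + δ) x
    rw [hdecomp, setAverage_eq]
    have hk : IntegrableOn (fun _ : Fin 2 → ℝ => k) Ω := integrableOn_const hvol
    have hkr : IntegrableOn (fun x => k + r x) Ω := hk.add hr.integrableOn
    rw [integral_add hkr hw.integrableOn, integral_add hk hr.integrableOn, hrΩ,
      setIntegral_const, smul_eq_mul, smul_eq_mul]
    have hw0 : 0 ≤ ∫ x in Ω, w x :=
      integral_nonneg fun x => mul_nonneg (by positivity) (mul_self_nonneg _)
    rw [add_zero, mul_add, ← mul_assoc, inv_mul_cancel₀ hpos.ne', one_mul]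
    exact le_add_of_nonneg_right (mul_nonneg (inv_nonneg.2 hpos.le) hw0)

/-! ### Quasiconvex functions along rank-one segments -/

section Laminates

open Filter Topology

theorem exists_contDiff_plateau {ε : ℝ} (hε : 0 < ε) :
    ∃ b : ℝ → ℝ, ContDiff ℝ (⊤ : ℕ∞) b ∧ (∀ s, 0 ≤ b s) ∧ (∀ s, b s ≤ 1) ∧ (∀ s ≤ 0, b s = 0) ∧
      (∀ s, 1 ≤ s → b s = 0) ∧ ∀ s, ε ≤ s → s ≤ 1 - ε → b s = 1 := by
  refine ⟨fun s => Real.smoothTransition (s / ε) * Real.smoothTransition ((1 - s) / ε),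
    ?_, fun s => ?_, fun s => ?_, fun s hs => ?_, fun s hs => ?_, fun s h1 h2 => ?_⟩
  · exact (Real.smoothTransition.contDiff.comp (contDiff_id.div_const _)).mul
      (Real.smoothTransition.contDiff.comp ((contDiff_const.sub contDiff_id).div_const _))
  · exact mul_nonneg (Real.smoothTransition.nonneg _) (Real.smoothTransition.nonneg _)
  · exact mul_le_one₀ (Real.smoothTransition.le_one _) (Real.smoothTransition.nonneg _)
      (Real.smoothTransition.le_one _)
  · simp only [Real.smoothTransition.zero_of_nonpos (div_nonpos_of_nonpos_of_nonneg hs hε.le),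
      zero_mul]
  · simp only [Real.smoothTransition.zero_of_nonpos
      (div_nonpos_of_nonpos_of_nonneg (sub_nonpos.2 hs) hε.le), mul_zero]
  · simp only [Real.smoothTransition.one_of_one_le ((one_le_div hε).2 h1),
      Real.smoothTransition.one_of_one_le ((one_le_div hε).2 (by linarith : ε ≤ 1 - s)), mul_one]

/-- One smoothed tooth: slope `1 - t` on most of `[0, t]`, slope `-t` on most of `[t, 1]`. Rise and
fall are rescaled copies of the same primitive of a plateau, so they cancel exactly and the tooth
has support in `[0, 1]`. -/
theorem exists_contDiff_sawtooth {t ε : ℝ} (ht0 : 0 < t) (ht1 : t < 1) (hε : 0 < ε) :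
    ∃ h h' : ℝ → ℝ, ContDiff ℝ (⊤ : ℕ∞) h ∧ (∀ s, HasDerivAt h (h' s) s) ∧ (∀ s, |h s| ≤ 1) ∧
      (∀ s, |h' s| ≤ 1) ∧ (∀ s ≤ 0, h s = 0) ∧ (∀ s, 1 ≤ s → h s = 0) ∧
      (∀ s, t * ε < s → s < t * (1 - ε) → h' s = 1 - t) ∧
      ∀ s, t + (1 - t) * ε < s → s < t + (1 - t) * (1 - ε) → h' s = -t := by
  obtain ⟨b, hb, b0, b1, bl, br, bm⟩ := exists_contDiff_plateau hε
  have ht1' : 0 < 1 - t := by linarith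
  let P : ℝ → ℝ := fun s => ∫ x in (0 : ℝ)..s, b x
  have hP : ∀ s, HasDerivAt P (b s) s := fun s =>
    (hb.continuous.integral_hasStrictDerivAt 0 s).hasDerivAt
  have hPsm : ContDiff ℝ (⊤ : ℕ∞) P := by
    refine contDiff_infty_iff_deriv.2 ⟨fun s => (hP s).differentiableAt, ?_⟩
    rwa [show deriv P = b from funext fun s => (hP s).deriv]
  have hP0 : ∀ s ≤ 0, P s = 0 := by
    intro s hs
    refine intervalIntegral.integral_zero_ae (Eventually.of_forall fun x hx => bl x ?_)
    rw [uIoc_of_ge hs] at hx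
    exact hx.2
  have hP1 : ∀ s, 1 ≤ s → P s = P 1 := by
    intro s hs
    have h := intervalIntegral.integral_add_adjacent_intervals
      (hb.continuous.intervalIntegrable (μ := volume) 0 1)
      (hb.continuous.intervalIntegrable (μ := volume) 1 s)
    have h0 : ∫ x in (1 : ℝ)..s, b x = 0 := by
      refine intervalIntegral.integral_zero_ae (Eventually.of_forall fun x hx => br x ?_)
      rw [uIoc_of_le hs] at hx
      exact hx.1.le
    rw [h0, add_zero] at h
    exact h.symm
  have hPmono : Monotone P :=
    monotone_of_deriv_nonneg (fun s => (hP s).differentiableAt)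
      fun s => by rw [(hP s).deriv]; exact b0 s
  have hPnn : ∀ s, 0 ≤ P s := by
    intro s
    rcases le_total s 0 with h | h
    · rw [hP0 s h]
    · have := hPmono h
      rwa [hP0 0 le_rfl] at this
  have hPle : ∀ s, P s ≤ 1 := by
    intro s
    have h1 : P 1 ≤ 1 := by
      have := intervalIntegral.norm_integral_le_of_norm_le_const (a := (0 : ℝ)) (b := 1) (C := 1)
        (f := b) fun x _ => by rw [Real.norm_eq_abs, abs_of_nonneg (b0 x)]; exact b1 x
      rw [sub_zero, abs_one, mul_one] at this
      exact (le_abs_self _).trans this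
    rcases le_total s 1 with h | h
    · exact (hPmono h).trans h1
    · rwa [hP1 s h]
  refine ⟨fun s => t * (1 - t) * (P (s / t) - P ((s - t) / (1 - t))),
    fun s => (1 - t) * b (s / t) - t * b ((s - t) / (1 - t)), ?_, fun s => ?_, fun s => ?_,
    fun s => ?_, fun s hs => ?_, fun s hs => ?_, fun s h1 h2 => ?_, fun s h1 h2 => ?_⟩
  · exact contDiff_const.mul ((hPsm.comp (contDiff_id.div_const _)).sub
      (hPsm.comp ((contDiff_id.sub contDiff_const).div_const _)))
  · have d1 : HasDerivAt (fun s => P (s / t)) (b (s / t) * (1 / t)) s :=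
      HasDerivAt.comp (h₂ := P) (h := fun s => s / t) s (hP (s / t))
        ((hasDerivAt_id s).div_const t)
    have d2 : HasDerivAt (fun s => P ((s - t) / (1 - t)))
        (b ((s - t) / (1 - t)) * (1 / (1 - t))) s :=
      HasDerivAt.comp (h₂ := P) (h := fun s => (s - t) / (1 - t)) s (hP ((s - t) / (1 - t)))
        (((hasDerivAt_id s).sub_const t).div_const (1 - t))
    refine ((d1.sub d2).const_mul (t * (1 - t))).congr_deriv ?_
    have := ht1'.ne'
    field_simp
  · have h1 : |P (s / t) - P ((s - t) / (1 - t))| ≤ 1 := by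
      rw [abs_le]
      constructor <;> linarith [hPnn (s / t), hPle (s / t), hPnn ((s - t) / (1 - t)),
        hPle ((s - t) / (1 - t))]
    rw [abs_mul, abs_of_pos (mul_pos ht0 ht1')]
    exact mul_le_one₀ (mul_le_one₀ ht1.le ht1'.le (by linarith)) (abs_nonneg _) h1
  · have e1 := mul_le_of_le_one_right ht1'.le (b1 (s / t))
    have e2 := mul_le_of_le_one_right ht0.le (b1 ((s - t) / (1 - t)))
    have e3 := mul_nonneg ht1'.le (b0 (s / t))
    have e4 := mul_nonneg ht0.le (b0 ((s - t) / (1 - t)))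
    rw [abs_le]
    constructor <;> linarith
  · simp only [hP0 _ (div_nonpos_of_nonpos_of_nonneg hs ht0.le),
      hP0 _ (div_nonpos_of_nonpos_of_nonneg (by linarith : s - t ≤ 0) ht1'.le), sub_self, mul_zero]
  · simp only [hP1 _ ((one_le_div ht0).2 (by linarith : t ≤ s)),
      hP1 _ ((one_le_div ht1').2 (by linarith : 1 - t ≤ s - t)), sub_self, mul_zero]
  · have e1 : b (s / t) = 1 := bm _ ((le_div_iff₀ ht0).2 (by linarith))
      ((div_le_iff₀ ht0).2 (by linarith))
    have e2 : b ((s - t) / (1 - t)) = 0 := by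
      refine bl _ (div_nonpos_of_nonpos_of_nonneg ?_ ht1'.le)
      have : 0 < t * ε := by positivity
      linarith
    simp only [e1, e2, mul_one, mul_zero, sub_zero]
  · have e1 : b (s / t) = 0 := by
      refine br _ ((one_le_div ht0).2 ?_)
      have : 0 < (1 - t) * ε := by positivity
      linarith
    have e2 : b ((s - t) / (1 - t)) = 1 := bm _ ((le_div_iff₀ ht1').2 (by linarith))
      ((div_le_iff₀ ht1').2 (by linarith))
    simp only [e1, e2, mul_one, mul_zero, zero_sub]

theorem exists_smoothTransition_deriv_bound :
    ∃ D : ℝ, 0 ≤ D ∧ ∀ s, |deriv Real.smoothTransition s| ≤ D := by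
  have hsm : ContDiff ℝ (⊤ : ℕ∞) Real.smoothTransition := Real.smoothTransition.contDiff
  have hc : Continuous (deriv Real.smoothTransition) :=
    (contDiff_infty_iff_deriv.1 hsm).2.continuous
  obtain ⟨D, hD⟩ := (isCompact_Icc (a := (0 : ℝ)) (b := 1)).exists_bound_of_continuousOn
    hc.continuousOn
  have hD0 : 0 ≤ D := (norm_nonneg _).trans (hD 0 (by simp))
  refine ⟨D, hD0, fun s => ?_⟩
  by_cases hs : s ∈ Icc (0 : ℝ) 1
  · exact hD s hs
  · have : deriv Real.smoothTransition s = 0 := by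
      rw [mem_Icc, not_and_or, not_le, not_le] at hs
      rcases hs with hs | hs
      · have : Real.smoothTransition =ᶠ[𝓝 s] fun _ => 0 := by
          filter_upwards [Iio_mem_nhds hs] with x hx
          exact Real.smoothTransition.zero_of_nonpos (le_of_lt hx)
        rw [this.deriv_eq, deriv_const]
      · have : Real.smoothTransition =ᶠ[𝓝 s] fun _ => 1 := by
          filter_upwards [Ioi_mem_nhds hs] with x hx
          exact Real.smoothTransition.one_of_one_le (le_of_lt hx)
        rw [this.deriv_eq, deriv_const]
    rw [this, abs_zero]
    exact hD0

/-- Smooth cutoffs of long intervals, with derivatives bounded independently of the length. -/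
theorem exists_contDiff_cutoff :
    ∃ D : ℝ, 0 ≤ D ∧ ∀ N : ℝ, ∃ η η' : ℝ → ℝ, ContDiff ℝ (⊤ : ℕ∞) η ∧
      (∀ s, HasDerivAt η (η' s) s) ∧ (∀ s, |η s| ≤ 1) ∧ (∀ s, |η' s| ≤ D) ∧
      (∀ s ≤ 0, η s = 0) ∧ (∀ s, N ≤ s → η s = 0) ∧
      (∀ s, 1 < s → s < N - 1 → η s = 1 ∧ η' s = 0) := by
  obtain ⟨D, hD0, hD⟩ := exists_smoothTransition_deriv_bound
  refine ⟨D + D, by positivity, fun N => ?_⟩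
  set σ := Real.smoothTransition with hσ
  have hsm : ContDiff ℝ (⊤ : ℕ∞) σ := Real.smoothTransition.contDiff
  have hd : ∀ s, HasDerivAt σ (deriv σ s) s := fun s =>
    ((hsm.differentiable (by simp)) s).hasDerivAt
  have habs : ∀ s, |σ s| ≤ 1 := fun s => by
    rw [abs_of_nonneg (Real.smoothTransition.nonneg s)]
    exact Real.smoothTransition.le_one s
  have hder : ∀ s, HasDerivAt (fun s => σ s * σ (N - s))
      (deriv σ s * σ (N - s) + σ s * (deriv σ (N - s) * -1)) s := fun s =>
    (hd s).mul ((hd (N - s)).comp s ((hasDerivAt_id s).const_sub N))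
  refine ⟨fun s => σ s * σ (N - s),
    fun s => deriv σ s * σ (N - s) + σ s * (deriv σ (N - s) * -1), ?_, hder, fun s => ?_,
    fun s => ?_, fun s hs => ?_, fun s hs => ?_, fun s h1 h2 => ⟨?_, ?_⟩⟩
  · exact hsm.mul (hsm.comp (contDiff_const.sub contDiff_id))
  · rw [abs_mul]
    exact mul_le_one₀ (habs _) (abs_nonneg _) (habs _)
  · refine (abs_add_le _ _).trans (add_le_add ?_ ?_)
    · rw [abs_mul]
      exact (mul_le_of_le_one_right (abs_nonneg _) (habs _)).trans (hD s)
    · rw [abs_mul, mul_neg_one, abs_neg]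
      exact (mul_le_of_le_one_left (abs_nonneg _) (habs _)).trans (hD _)
  · simp only [hσ, Real.smoothTransition.zero_of_nonpos hs, zero_mul]
  · simp only [hσ, Real.smoothTransition.zero_of_nonpos (sub_nonpos.2 hs), mul_zero]
  · simp only [hσ, Real.smoothTransition.one_of_one_le h1.le,
      Real.smoothTransition.one_of_one_le (by linarith : 1 ≤ N - s), mul_one]
  · have hev : (fun s => σ s * σ (N - s)) =ᶠ[𝓝 s] fun _ => 1 := by
      filter_upwards [Ioo_mem_nhds h1 h2] with x hx
      simp only [hσ, Real.smoothTransition.one_of_one_le hx.1.le,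
        Real.smoothTransition.one_of_one_le (by linarith [hx.2] : 1 ≤ N - x), mul_one]
    exact (hder s).deriv.symm.trans (by rw [hev.deriv_eq, deriv_const])

/-- The linear map sending a point to its coordinates along `n` and along `n` rotated by a right
angle. -/
noncomputable def rotCoord (n : Fin 2 → ℝ) : (Fin 2 → ℝ) →ₗ[ℝ] (Fin 2 → ℝ) :=
  Matrix.toLin' !![n 0, n 1; -n 1, n 0]

theorem det_rotCoord (n : Fin 2 → ℝ) : LinearMap.det (rotCoord n) = n 0 ^ 2 + n 1 ^ 2 := by
  rw [rotCoord, LinearMap.det_toLin', Matrix.det_fin_two_of]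
  ring

theorem det_rotCoord_ne_zero {n : Fin 2 → ℝ} (hn : n ≠ 0) : LinearMap.det (rotCoord n) ≠ 0 := by
  rw [det_rotCoord]
  intro h
  apply hn
  have h0 : n 0 = 0 := by nlinarith [sq_nonneg (n 0), sq_nonneg (n 1)]
  have h1 : n 1 = 0 := by nlinarith [sq_nonneg (n 0), sq_nonneg (n 1)]
  ext i
  fin_cases i <;> simpa

/-- A linear change of the independent variable adapted to the direction `n`, as a
homeomorphism. -/
noncomputable def rotCoordEquiv {n : Fin 2 → ℝ} (hn : n ≠ 0) : (Fin 2 → ℝ) ≃L[ℝ] (Fin 2 → ℝ) :=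
  (LinearMap.equivOfDetNeZero (rotCoord n) (det_rotCoord_ne_zero hn)).toContinuousLinearEquiv

theorem rotCoord_apply_zero (n x : Fin 2 → ℝ) : rotCoord n x 0 = n 0 * x 0 + n 1 * x 1 := by
  simp [rotCoord, Matrix.toLin'_apply, Matrix.mulVec, dotProduct, Fin.sum_univ_two]

theorem rotCoord_apply_one (n x : Fin 2 → ℝ) : rotCoord n x 1 = -n 1 * x 0 + n 0 * x 1 := by
  simp [rotCoord, Matrix.toLin'_apply, Matrix.mulVec, dotProduct, Fin.sum_univ_two]

/-- An open box. -/
def box (p q r s : ℝ) : Set (Fin 2 → ℝ) := {y | (p < y 0 ∧ y 0 < q) ∧ r < y 1 ∧ y 1 < s}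

theorem isOpen_box (p q r s : ℝ) : IsOpen (box p q r s) := by
  have h0 : Continuous fun y : Fin 2 → ℝ => y 0 := continuous_apply 0
  have h1 : Continuous fun y : Fin 2 → ℝ => y 1 := continuous_apply 1
  exact ((isOpen_lt continuous_const h0).inter (isOpen_lt h0 continuous_const)).inter
    ((isOpen_lt continuous_const h1).inter (isOpen_lt h1 continuous_const))

theorem box_eq_pi (p q r s : ℝ) :
    box p q r s = Set.pi univ fun i => Ioo ((![p, r] : Fin 2 → ℝ) i) ((![q, s] : Fin 2 → ℝ) i) := by
  ext y
  simp [box, Fin.forall_fin_two]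

theorem volume_real_box {p q r s : ℝ} (hpq : p ≤ q) (hrs : r ≤ s) :
    volume.real (box p q r s) = (q - p) * (s - r) := by
  rw [box_eq_pi, measureReal_def, Real.volume_pi_Ioo_toReal]
  · simp [Fin.prod_univ_two]
  · intro i
    fin_cases i <;> simpa

theorem volume_real_preimage_rotCoord {n : Fin 2 → ℝ} (hn : n ≠ 0) (S : Set (Fin 2 → ℝ)) :
    volume.real (rotCoord n ⁻¹' S) = |(LinearMap.det (rotCoord n))⁻¹| * volume.real S := by
  rw [measureReal_def, Measure.addHaar_preimage_linearMap _ (det_rotCoord_ne_zero hn),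
    ENNReal.toReal_mul, ENNReal.toReal_ofReal (abs_nonneg _), measureReal_def]

theorem hasFDerivAt_rotCoord_apply (n x : Fin 2 → ℝ) (i : Fin 2) :
    HasFDerivAt (fun x => rotCoord n x i)
      ((ContinuousLinearMap.proj i).comp (LinearMap.toContinuousLinearMap (rotCoord n)) :
        (Fin 2 → ℝ) →L[ℝ] ℝ) x :=
  ((ContinuousLinearMap.proj i).comp (LinearMap.toContinuousLinearMap (rotCoord n)) :
        (Fin 2 → ℝ) →L[ℝ] ℝ).hasFDerivAt

/-- The direction of `n` rotated by a right angle. -/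
def perp (n : Fin 2 → ℝ) : Fin 2 → ℝ := ![-n 1, n 0]

theorem jacobian_laminate {h h' η η' : ℝ → ℝ} (hh : ∀ s, HasDerivAt h (h' s) s)
    (hη : ∀ s, HasDerivAt η (η' s) s) (a n x : Fin 2 → ℝ) :
    jacobian (fun x i => h (rotCoord n x 0) * η (rotCoord n x 1) * a i) x =
      Matrix.vecMulVec a ((h' (rotCoord n x 0) * η (rotCoord n x 1)) • n
        + (h (rotCoord n x 0) * η' (rotCoord n x 1)) • perp n) := by
  have d := ((hh (rotCoord n x 0)).comp_hasFDerivAt x (hasFDerivAt_rotCoord_apply n x 0)).mul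
    ((hη (rotCoord n x 1)).comp_hasFDerivAt x (hasFDerivAt_rotCoord_apply n x 1))
  have dφ := hasFDerivAt_pi.2 fun i : Fin 2 => d.mul_const (a i)
  ext i j
  have e : fderiv ℝ (fun x i => h (rotCoord n x 0) * η (rotCoord n x 1) * a i) x = _ := dφ.fderiv
  simp only [jacobian, Matrix.of_apply]
  rw [e]
  simp only [ContinuousLinearMap.coe_pi', smul_apply,
    add_apply, ContinuousLinearMap.comp_apply, ContinuousLinearMap.proj_apply,
    LinearMap.coe_toContinuousLinearMap', smul_eq_mul, Function.comp_apply,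
    rotCoord_apply_zero, rotCoord_apply_one, Matrix.vecMulVec_apply, Pi.add_apply, Pi.smul_apply]
  fin_cases j <;> simp [perp, -mul_eq_mul_left_iff, -mul_eq_mul_right_iff] <;> ring

theorem contDiff_laminate {h η : ℝ → ℝ} (hh : ContDiff ℝ (⊤ : ℕ∞) h)
    (hη : ContDiff ℝ (⊤ : ℕ∞) η) (a n : Fin 2 → ℝ) :
    ContDiff ℝ (⊤ : ℕ∞) fun x i => h (rotCoord n x 0) * η (rotCoord n x 1) * a i := by
  have hL : ∀ i, ContDiff ℝ (⊤ : ℕ∞) fun x => rotCoord n x i := fun i =>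
    ((ContinuousLinearMap.proj i).comp (LinearMap.toContinuousLinearMap (rotCoord n)) :
        (Fin 2 → ℝ) →L[ℝ] ℝ).contDiff
  exact contDiff_pi.2 fun i => ((hh.comp (hL 0)).mul (hη.comp (hL 1))).mul contDiff_const

/-- Test with one tooth across `n`, cut off along a length `N`. Instead of oscillating ever faster
on a fixed domain, the domain is stretched: all gradients stay in a compact set independent of `N`,
where `|g| ≤ C`, and they equal `A` or `B` off a vanishing fraction of the box. -/
theorem IsQuasiconvex.le_add_mul_max {g : Mat → ℝ} (hg : IsQuasiconvex g) {A B : Mat}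
    {a n : Fin 2 → ℝ} (hn : n ≠ 0) (hAB : A - B = Matrix.vecMulVec a n) {t : ℝ} (ht0 : 0 < t)
    (ht1 : t < 1) :
    ∃ C : ℝ, ∀ N : ℕ, 2 < N →
      g (t • A + (1 - t) • B) ≤
        C + (max (g A) (g B) - C) * (((N : ℝ) - 2) / (N + 2)) ^ 2 := by
  obtain ⟨hmeas, hloc, hq⟩ := hg
  set M := t • A + (1 - t) • B with hM
  have hMA : M + Matrix.vecMulVec a ((1 - t) • n) = A := by
    rw [Matrix.vecMulVec_smul, ← hAB, hM]; module
  have hMB : M + Matrix.vecMulVec a ((-t) • n) = B := by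
    rw [Matrix.vecMulVec_smul, ← hAB, hM]; module
  obtain ⟨D, hD0, hcut⟩ := exists_contDiff_cutoff
  -- All values of `M + Dφ` have this form, with parameters in `[-1, 1] × [-D, D]`.
  let Ψ : ℝ × ℝ → Mat := fun p => M + Matrix.vecMulVec a (p.1 • n + p.2 • perp n)
  have hΨ : Continuous Ψ := by
    refine continuous_const.add (continuous_matrix fun i j => ?_)
    simp only [Matrix.vecMulVec_apply, Pi.add_apply, Pi.smul_apply, smul_eq_mul]
    fun_prop
  obtain ⟨C, hC⟩ := hloc _ (((isCompact_Icc (a := (-1 : ℝ)) (b := 1)).prod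
    (isCompact_Icc (a := -D) (b := D))).image hΨ)
  have hCΨ : ∀ p q : ℝ, |p| ≤ 1 → |q| ≤ D → |g (Ψ (p, q))| ≤ C := fun p q hp hq' =>
    hC _ ⟨(p, q), ⟨abs_le.1 hp, abs_le.1 hq'⟩, rfl⟩
  have hΨA : Ψ (1 - t, 0) = A := by simpa [Ψ] using hMA
  have hΨB : Ψ (-t, 0) = B := by simpa [Ψ] using hMB
  refine ⟨C, fun N hN => ?_⟩
  have hN' : (2 : ℝ) < N := by exact_mod_cast hN
  have hNpos : (0 : ℝ) < N := by linarith
  set ε : ℝ := 1 / N with hε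
  have hε0 : 0 < ε := by positivity
  have hε1 : ε < 1 / 2 := one_div_lt_one_div_of_lt (by norm_num) hN'
  obtain ⟨h, h', hsm, hder, hb, hb', hl, hr, hA, hB⟩ := exists_contDiff_sawtooth ht0 ht1 hε0
  obtain ⟨η, η', ηsm, ηder, ηb, ηb', ηl, ηr, ηm⟩ := hcut N
  let φ : (Fin 2 → ℝ) → (Fin 2 → ℝ) := fun x i =>
    h (rotCoord n x 0) * η (rotCoord n x 1) * a i
  have hφ : ContDiff ℝ (⊤ : ℕ∞) φ := contDiff_laminate hsm ηsm a n
  have hjac : ∀ x, M + jacobian φ x = Ψ (h' (rotCoord n x 0) * η (rotCoord n x 1),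
      h (rotCoord n x 0) * η' (rotCoord n x 1)) := fun x => by
    rw [jacobian_laminate hder ηder a n x]
  let e := rotCoordEquiv hn
  let Q : Set (Fin 2 → ℝ) := Set.pi univ fun i =>
    Icc ((![-ε, -1] : Fin 2 → ℝ) i) ((![1 + ε, N + 1] : Fin 2 → ℝ) i)
  have hQ : IsCompact (e ⁻¹' Q) :=
    e.toHomeomorph.isCompact_preimage.2 (isCompact_univ_pi fun i => isCompact_Icc)
  -- The margins `ε = 1/N` and `1` make room around the closed support, and turn the volume fraction
  -- of the good set into exactly `((N - 2) / (N + 2))²`.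
  let Ω : Set (Fin 2 → ℝ) := rotCoord n ⁻¹' box (-ε) (1 + ε) (-1) (N + 1)
  have hΩQ : Ω ⊆ e ⁻¹' Q := by
    intro x hx i _
    obtain ⟨⟨h1, h2⟩, h3, h4⟩ := hx
    fin_cases i
    · exact ⟨h1.le, h2.le⟩
    · exact ⟨h3.le, h4.le⟩
  have hcont : Continuous (rotCoord n) := (rotCoord n).continuous_of_finiteDimensional
  have hΩo : IsOpen Ω := (isOpen_box _ _ _ _).preimage hcont
  have hΩb : Bornology.IsBounded Ω := hQ.isBounded.subset hΩQ
  have hΩne : Ω.Nonempty := by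
    refine ⟨0, ?_⟩
    simp only [Ω, mem_preimage, map_zero, box, mem_ofPred_eq, Pi.zero_apply]
    refine ⟨⟨?_, ?_⟩, ?_, ?_⟩ <;> linarith
  let Z : Set (Fin 2 → ℝ) := {y | (0 ≤ y 0 ∧ y 0 ≤ 1) ∧ 0 ≤ y 1 ∧ y 1 ≤ N}
  have hZc : IsClosed Z := by
    have h0 : Continuous fun y : Fin 2 → ℝ => y 0 := continuous_apply 0
    have h1 : Continuous fun y : Fin 2 → ℝ => y 1 := continuous_apply 1
    exact ((isClosed_le continuous_const h0).inter (isClosed_le h0 continuous_const)).inter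
      ((isClosed_le continuous_const h1).inter (isClosed_le h1 continuous_const))
  have hts : tsupport φ ⊆ rotCoord n ⁻¹' Z := by
    refine closure_minimal (fun x hx => ?_) (hZc.preimage hcont)
    by_contra hxZ
    apply hx
    have : h (rotCoord n x 0) * η (rotCoord n x 1) = 0 := by
      simp only [Z, mem_preimage, mem_ofPred_eq, not_and_or, not_le] at hxZ
      rcases hxZ with (h1 | h1) | h1 | h1
      · rw [hl _ h1.le, zero_mul]
      · rw [hr _ h1.le, zero_mul]
      · rw [ηl _ h1.le, mul_zero]
      · rw [ηr _ h1.le, mul_zero]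
    ext i
    simp [φ, this]
  have hZΩ : rotCoord n ⁻¹' Z ⊆ Ω := by
    rintro x ⟨⟨h1, h2⟩, h3, h4⟩
    exact ⟨⟨by linarith, by linarith⟩, by linarith, by linarith⟩
  have htsΩ : tsupport φ ⊆ Ω := hts.trans hZΩ
  have hcs : HasCompactSupport φ :=
    hQ.of_isClosed_subset (isClosed_tsupport φ) (htsΩ.trans hΩQ)
  have key := hq Ω hΩo hΩne hΩb φ hφ hcs htsΩ M
  let S₁ := box (t * ε) (t * (1 - ε)) 1 (N - 1)
  let S₂ := box (t + (1 - t) * ε) (t + (1 - t) * (1 - ε)) 1 (N - 1)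
  let G := rotCoord n ⁻¹' (S₁ ∪ S₂)
  have ht1' : 0 < 1 - t := by linarith
  have htε : 0 < t * ε := by positivity
  have htε' : 0 < (1 - t) * ε := by positivity
  have hGo : IsOpen G := ((isOpen_box _ _ _ _).union (isOpen_box _ _ _ _)).preimage hcont
  have hGΩ : G ⊆ Ω := by
    rintro x (⟨⟨h1, h2⟩, h3, h4⟩ | ⟨⟨h1, h2⟩, h3, h4⟩)
    · exact ⟨⟨by linarith, by linarith⟩, by linarith, by linarith⟩
    · exact ⟨⟨by linarith, by linarith⟩, by linarith, by linarith⟩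
  set m := max (g A) (g B) with hm
  have hFC : ∀ x, |g (M + jacobian φ x)| ≤ C := by
    intro x
    rw [hjac]
    refine hCΨ _ _ ?_ ?_
    · rw [abs_mul]
      exact mul_le_one₀ (hb' _) (abs_nonneg _) (ηb _)
    · rw [abs_mul]
      exact (mul_le_of_le_one_left (abs_nonneg _) (hb _)).trans (ηb' _)
  have hFm : ∀ x ∈ G, g (M + jacobian φ x) ≤ m := by
    rintro x (⟨⟨h1, h2⟩, h3, h4⟩ | ⟨⟨h1, h2⟩, h3, h4⟩)
    · obtain ⟨e1, e2⟩ := ηm _ h3 h4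
      rw [hjac, e1, e2, hA _ h1 h2, mul_one, mul_zero, hΨA]
      exact le_max_left _ _
    · obtain ⟨e1, e2⟩ := ηm _ h3 h4
      rw [hjac, e1, e2, hB _ h1 h2, mul_one, mul_zero, hΨB]
      exact le_max_right _ _
  have hvΩ : volume Ω ≠ ⊤ := hΩb.measure_lt_top.ne
  have hFmeas : Measurable fun x => g (M + jacobian φ x) := by
    have hc : Continuous fun x => M + jacobian φ x := continuous_const.add (continuous_jacobian hφ)
    have hb := hc.borel_measurable
    rw [← BorelSpace.measurable_eq (α := Fin 2 → ℝ)] at hb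
    exact hmeas.comp hb
  have hFint : IntegrableOn (fun x => g (M + jacobian φ x)) Ω :=
    IntegrableOn.of_bound (C := C) (lt_top_iff_ne_top.2 hvΩ) hFmeas.aestronglyMeasurable
      (Eventually.of_forall hFC)
  have hHint1 : IntegrableOn (fun _ : Fin 2 → ℝ => C) Ω := integrableOn_const hvΩ
  have hHint2 : IntegrableOn (G.indicator fun _ => m - C) Ω :=
    (integrableOn_const hvΩ).indicator hGo.measurableSet
  have hle : ∫ x in Ω, g (M + jacobian φ x) ≤ ∫ x in Ω, (C + G.indicator (fun _ => m - C) x) := by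
    refine integral_mono hFint (hHint1.add hHint2) fun x => ?_
    by_cases hx : x ∈ G
    · simpa [hx] using hFm x hx
    · simpa [hx] using (le_abs_self _).trans (hFC x)
  have hint : ∫ x in Ω, (C + G.indicator (fun _ => m - C) x)
      = volume.real Ω * C + volume.real G * (m - C) := by
    rw [integral_add hHint1 hHint2, setIntegral_const, setIntegral_indicator hGo.measurableSet,
      inter_eq_self_of_subset_right hGΩ, setIntegral_const, smul_eq_mul, smul_eq_mul]
  have hdisj : Disjoint S₁ S₂ := by
    refine Set.disjoint_left.2 fun y hy hy' => ?_
    have h1 := hy.1.2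
    have h2 := hy'.1.1
    linarith
  set κ := |(LinearMap.det (rotCoord n))⁻¹| with hκ
  have hκ0 : 0 < κ := abs_pos.2 (inv_ne_zero (det_rotCoord_ne_zero hn))
  have hbt : ∀ p q r s : ℝ, volume (box p q r s) ≠ ⊤ := by
    intro p q r s
    rw [box_eq_pi, Real.volume_pi_Ioo]
    exact ENNReal.prod_ne_top fun i _ => ENNReal.ofReal_ne_top
  have hvolG : volume.real G = κ * ((1 - 2 * ε) * (N - 2)) := by
    rw [volume_real_preimage_rotCoord hn,
      measureReal_union hdisj (isOpen_box _ _ _ _).measurableSet (hbt _ _ _ _) (hbt _ _ _ _),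
      volume_real_box (by nlinarith) (by linarith), volume_real_box (by nlinarith) (by linarith)]
    ring
  have hvolΩ : volume.real Ω = κ * ((1 + 2 * ε) * (N + 2)) := by
    rw [volume_real_preimage_rotCoord hn, volume_real_box (by linarith) (by linarith)]
    ring
  have hvpos : 0 < volume.real Ω := by rw [hvolΩ]; positivity
  rw [setAverage_eq, smul_eq_mul] at key
  refine key.trans ((mul_le_mul_of_nonneg_left (hle.trans_eq hint)
    (inv_nonneg.2 hvpos.le)).trans_eq ?_)
  rw [mul_add, ← mul_assoc, inv_mul_cancel₀ hvpos.ne', one_mul, ← mul_assoc, mul_comm _ (m - C)]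
  congr 2
  rw [hvolG, hvolΩ, hε]
  field_simp

/-- A quasiconvex function is quasiconvex along segments with rank-one direction, in the sense of
level sets. -/
theorem IsQuasiconvex.le_max_of_vecMulVec {g : Mat → ℝ} (hg : IsQuasiconvex g) {A B : Mat}
    {a n : Fin 2 → ℝ} (hAB : A - B = Matrix.vecMulVec a n) {t : ℝ} (ht0 : 0 ≤ t)
    (ht1 : t ≤ 1) : g (t • A + (1 - t) • B) ≤ max (g A) (g B) := by
  rcases ht0.eq_or_lt with rfl | ht0
  · simp
  rcases ht1.eq_or_lt with rfl | ht1
  · simp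
  by_cases hn : n = 0
  · have : A = B := by
      rw [← sub_eq_zero, hAB, hn]; ext; simp [Matrix.vecMulVec_apply]
    rw [this, ← add_smul]
    simp
  obtain ⟨C, hC⟩ := hg.le_add_mul_max hn hAB ht0 ht1
  have hlim : Tendsto (fun N : ℕ => ((N : ℝ) - 2) / (N + 2)) atTop (𝓝 1) := by
    have h1 : Tendsto (fun N : ℕ => (4 : ℝ) / ((N : ℝ) + 2)) atTop (𝓝 0) :=
      tendsto_const_nhds.div_atTop
        (tendsto_atTop_add_const_right _ _ tendsto_natCast_atTop_atTop)
    have h2 := h1.const_sub 1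
    rw [sub_zero] at h2
    refine h2.congr fun N => ?_
    have : (N : ℝ) + 2 ≠ 0 := by positivity
    field_simp
    ring
  have hlim' : Tendsto (fun N : ℕ => C + (max (g A) (g B) - C) * (((N : ℝ) - 2) / (N + 2)) ^ 2)
      atTop (𝓝 (max (g A) (g B))) := by
    have := ((hlim.pow 2).const_mul (max (g A) (g B) - C)).const_add C
    simpa using this
  refine ge_of_tendsto hlim' ?_
  filter_upwards [eventually_gt_atTop 2] with N hN
  exact hC N hN

end Laminates

/-! ### Compatibility in terms of determinants -/

theorem exists_vecMulVec_of_det_eq_zero {M : Mat} (h : M.det = 0) :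
    ∃ a n : Fin 2 → ℝ, M = Matrix.vecMulVec a n := by
  rw [Matrix.det_fin_two] at h
  by_cases h0 : M 0 0 = 0
  · by_cases h1 : M 0 1 = 0
    · refine ⟨![0, 1], ![M 1 0, M 1 1], ?_⟩
      ext i j
      fin_cases i <;> fin_cases j <;> simp [Matrix.vecMulVec_apply, h0, h1]
    · have h2 : M 1 0 = 0 := by
        rw [h0, zero_mul, zero_sub, neg_eq_zero] at h
        exact (mul_eq_zero.1 h).resolve_left h1
      refine ⟨![M 0 1, M 1 1], ![0, 1], ?_⟩
      ext i j
      fin_cases i <;> fin_cases j <;> simp [Matrix.vecMulVec_apply, h0, h2]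
  · refine ⟨![M 0 0, M 1 0], ![1, M 0 1 / M 0 0], ?_⟩
    ext i j
    fin_cases i <;> fin_cases j <;> simp [Matrix.vecMulVec_apply] <;> field_simp
    linarith

theorem rank_le_one_iff_det_eq_zero (M : Mat) : M.rank ≤ 1 ↔ M.det = 0 := by
  constructor
  · intro h
    by_contra hd
    have := Matrix.rank_of_isUnit M ((Matrix.isUnit_iff_isUnit_det M).2 (isUnit_iff_ne_zero.2 hd))
    rw [Fintype.card_fin] at this
    omega
  · intro h
    obtain ⟨a, n, rfl⟩ := exists_vecMulVec_of_det_eq_zero h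
    exact Matrix.rank_vecMulVec_le a n

theorem rankOneCompatible_iff (A B : Mat) : RankOneCompatible A B ↔ (A - B).det = 0 :=
  rank_le_one_iff_det_eq_zero _

theorem apply_one_zero_of_isSymm {M : Mat} (h : M.IsSymm) : M 1 0 = M 0 1 := h.apply 0 1

/-- Adding a skew `S` to a symmetric matrix raises its determinant by `S₀₁²`, so determinant zero
can be reached exactly from a nonpositive value. -/
theorem compatible_iff {A B : Mat} (hA : A.IsSymm) (hB : B.IsSymm) :
    Compatible A B ↔ (A - B).det ≤ 0 := by
  have key : ∀ S : Mat, S.transpose = -S → (A - B + S).det = (A - B).det + S 0 1 ^ 2 := by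
    intro S hS
    have e : ∀ i j, S j i = -S i j := fun i j => by
      have := congrFun (congrFun hS i) j
      simpa using this
    have e0 : S 0 0 = 0 := by linarith [e 0 0]
    have e1 : S 1 1 = 0 := by linarith [e 1 1]
    simp only [Matrix.det_fin_two, Matrix.add_apply, Matrix.sub_apply, e0, e1, e 0 1,
      apply_one_zero_of_isSymm hA, apply_one_zero_of_isSymm hB]
    ring
  constructor
  · rintro ⟨S, hS, hr⟩
    rw [rank_le_one_iff_det_eq_zero, key S hS] at hr
    linarith [sq_nonneg (S 0 1)]
  · intro h
    have hS : (!![0, Real.sqrt (-(A - B).det); -Real.sqrt (-(A - B).det), 0] : Mat).transpose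
        = -!![0, Real.sqrt (-(A - B).det); -Real.sqrt (-(A - B).det), 0] := by
      ext i j
      fin_cases i <;> fin_cases j <;> simp
    refine ⟨_, hS, ?_⟩
    rw [rank_le_one_iff_det_eq_zero, key _ hS]
    simp only [Matrix.of_apply, Matrix.cons_val_zero, Matrix.cons_val_one]
    rw [Real.sq_sqrt (by linarith)]
    ring

/-! ### The lamination hull is contained in the quasiconvex hull -/

theorem symPart_of_isSymm {A : Mat} (hA : A.IsSymm) : symPart A = A := by
  rw [symPart, hA.eq, ← two_smul ℝ A, smul_smul]
  norm_num

theorem symPart_add_skew {A S : Mat} (hS : S.transpose = -S) : symPart (A + S) = symPart A := by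
  simp only [symPart, Matrix.transpose_add, hS]
  congr 1
  abel

/-- Shifting only `A` by the skew matrix makes the segment rank-one, and `f ∘ e` does not see the
shift, neither at the end nor at intermediate points. -/
theorem IsSymQuasiconvex.le_max {f : Mat → ℝ} (hf : IsSymQuasiconvex f) {A B : Mat}
    (hA : A.IsSymm) (hB : B.IsSymm) (hAB : Compatible A B) {t : ℝ} (ht0 : 0 ≤ t) (ht1 : t ≤ 1) :
    f (t • A + (1 - t) • B) ≤ max (f A) (f B) := by
  obtain ⟨S, hS, hr⟩ := hAB
  obtain ⟨a, n, han⟩ := exists_vecMulVec_of_det_eq_zero ((rank_le_one_iff_det_eq_zero _).1 hr)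
  have := IsQuasiconvex.le_max_of_vecMulVec (A := A + S) (B := B) hf
    (by rw [← han]; abel) ht0 ht1
  have e : t • (A + S) + (1 - t) • B = (t • A + (1 - t) • B) + t • S := by module
  have hsymm : (t • A + (1 - t) • B).IsSymm := (hA.smul t).add (hB.smul (1 - t))
  rw [e, symPart_add_skew (by rw [Matrix.transpose_smul, hS, smul_neg]), symPart_add_skew hS,
    symPart_of_isSymm hsymm, symPart_of_isSymm hA, symPart_of_isSymm hB] at this
  exact this

theorem isSymm_of_mem_lamHullStep {U : Set Mat} (hU : ∀ M ∈ U, M.IsSymm) :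
    ∀ i, ∀ M ∈ lamHullStep U i, M.IsSymm
  | 0, M, hM => hU M hM
  | i + 1, M, hM => by
    obtain ⟨A, hA, B, hB, -, t, -, -, rfl⟩ := hM
    exact ((isSymm_of_mem_lamHullStep hU i A hA).smul t).add
      ((isSymm_of_mem_lamHullStep hU i B hB).smul (1 - t))

theorem symLaminationHull_subset_symQuasiconvexHull {U : Set Mat} (hU : ∀ M ∈ U, M.IsSymm)
    (hfin : U.Finite) : symLaminationHull U ⊆ symQuasiconvexHull U := by
  refine iUnion_subset fun i M hM => ⟨isSymm_of_mem_lamHullStep hU i M hM, fun f hf => ?_⟩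
  induction i generalizing M with
  -- Finiteness bounds `f` on `U`, so that the `sSup` in the hull is a genuine supremum.
  | zero => exact le_csSup (hfin.image f).bddAbove (mem_image_of_mem f hM)
  | succ i ih =>
    obtain ⟨A, hA, B, hB, hAB, t, ht0, ht1, rfl⟩ := hM
    exact (hf.le_max (isSymm_of_mem_lamHullStep hU i A hA) (isSymm_of_mem_lamHullStep hU i B hB)
      hAB ht0 ht1).trans (max_le (ih A hA) (ih B hB))

theorem compatible_self (A : Mat) : Compatible A A :=
  ⟨0, by simp, by simp⟩

theorem monotone_lamHullStep (U : Set Mat) : Monotone (lamHullStep U) :=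
  monotone_nat_of_le_succ fun _ A hA =>
    ⟨A, hA, A, hA, compatible_self A, 1, zero_le_one, le_rfl, by simp⟩

theorem subset_symLaminationHull (U : Set Mat) : U ⊆ symLaminationHull U :=
  subset_iUnion (lamHullStep U) 0

theorem symLaminationHull_segment {U : Set Mat} {A B : Mat} (hA : A ∈ symLaminationHull U)
    (hB : B ∈ symLaminationHull U) (hAB : Compatible A B) {t : ℝ} (ht0 : 0 ≤ t) (ht1 : t ≤ 1) :
    t • A + (1 - t) • B ∈ symLaminationHull U := by
  obtain ⟨i, hi⟩ := mem_iUnion.1 hA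
  obtain ⟨j, hj⟩ := mem_iUnion.1 hB
  exact mem_iUnion.2 ⟨max i j + 1, A, monotone_lamHullStep U (le_max_left i j) hi, B,
    monotone_lamHullStep U (le_max_right i j) hj, hAB, t, ht0, ht1, rfl⟩

/-- Elements of the symmetric quasiconvex hull satisfy all polyconvex inequalities of first order
in the determinant. -/
theorem le_zero_of_mem_symQuasiconvexHull {U : Set Mat} (hne : U.Nonempty) {A : Mat}
    (hA : A ∈ symQuasiconvexHull U) {c : ℝ} (hc : 0 ≤ c) (α β γ δ : ℝ)
    (h : ∀ M ∈ U, -c * M.det + (α * M 0 0 + β * M 0 1 + γ * M 1 1) + δ ≤ 0) :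
    -c * A.det + (α * A 0 0 + β * A 0 1 + γ * A 1 1) + δ ≤ 0 := by
  refine (hA.2 _ (isSymQuasiconvex_neg_det_add_linear hc α β γ δ)).trans (csSup_le ?_ ?_)
  · exact hne.image _
  · rintro _ ⟨M, hM, rfl⟩
    exact h M hM

/-! ### Staircases in the plane -/

/-- A staircase: corners `(x i, y i)` increase in both coordinates, and the set consists of the
points `(x i, y (i + 1))` and `(x (i + 1), y i)` for two ranges of indices that differ by at most
one at either end. -/
structure IsStaircase (S : Set (ℝ × ℝ)) (x y : ℤ → ℝ) (a b c d : ℤ) : Prop where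
  strictMono_x : StrictMono x
  strictMono_y : StrictMono y
  left_le : a ≤ c + 1
  left_ge : c ≤ a + 1
  right_le : b ≤ d + 1
  right_ge : d ≤ b + 1
  ab : a ≤ b
  ad : a ≤ d
  cb : c ≤ b
  cd : c ≤ d
  mem_iff : ∀ p, p ∈ S ↔ (∃ i, a ≤ i ∧ i ≤ b ∧ p = (x i, y (i + 1))) ∨
    ∃ i, c ≤ i ∧ i ≤ d ∧ p = (x (i + 1), y i)

theorem IsStaircase.swap {S : Set (ℝ × ℝ)} {x y : ℤ → ℝ} {a b c d : ℤ}
    (h : IsStaircase S x y a b c d) : IsStaircase (Prod.swap ⁻¹' S) y x c d a b where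
  strictMono_x := h.strictMono_y
  strictMono_y := h.strictMono_x
  left_le := h.left_ge
  left_ge := h.left_le
  right_le := h.right_ge
  right_ge := h.right_le
  ab := h.cd
  ad := h.cb
  cb := h.ad
  cd := h.ab
  mem_iff := fun p => by
    obtain ⟨p1, p2⟩ := p
    simp only [mem_preimage, Prod.swap_prod_mk, h.mem_iff, Prod.mk.injEq]
    rw [or_comm]
    simp only [and_comm (a := p2 = _)]

/-- The point reflection exchanges the two families of points, and index `i` becomes `-i - 1`. -/
theorem IsStaircase.neg {S : Set (ℝ × ℝ)} {x y : ℤ → ℝ} {a b c d : ℤ}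
    (h : IsStaircase S x y a b c d) :
    IsStaircase (Neg.neg ⁻¹' S) (fun i => -x (-i)) (fun i => -y (-i)) (-d - 1) (-c - 1)
      (-b - 1) (-a - 1) where
  strictMono_x := fun i j hij => neg_lt_neg (h.strictMono_x (neg_lt_neg hij))
  strictMono_y := fun i j hij => neg_lt_neg (h.strictMono_y (neg_lt_neg hij))
  left_le := by linarith [h.right_le]
  left_ge := by linarith [h.right_ge]
  right_le := by linarith [h.left_le]
  right_ge := by linarith [h.left_ge]
  ab := by linarith [h.cd]
  ad := by linarith [h.ad]
  cb := by linarith [h.cb]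
  cd := by linarith [h.ab]
  mem_iff := fun p => by
    obtain ⟨p1, p2⟩ := p
    simp only [mem_preimage, Prod.neg_mk, h.mem_iff, Prod.mk.injEq]
    rw [or_comm]
    constructor
    · rintro (⟨i, h1, h2, h3, h4⟩ | ⟨i, h1, h2, h3, h4⟩)
      · refine Or.inl ⟨-i - 1, by omega, by omega, ?_, ?_⟩
        · rw [show -(-i - 1) = i + 1 by ring]; linarith
        · rw [show -(-i - 1 + 1) = i by ring]; linarith
      · refine Or.inr ⟨-i - 1, by omega, by omega, ?_, ?_⟩
        · rw [show -(-i - 1 + 1) = i by ring]; linarith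
        · rw [show -(-i - 1) = i + 1 by ring]; linarith
    · rintro (⟨i, h1, h2, h3, h4⟩ | ⟨i, h1, h2, h3, h4⟩)
      · refine Or.inl ⟨-i - 1, by omega, by omega, ?_, ?_⟩
        · rw [show -i - 1 + 1 = -i by ring]; linarith
        · rw [show -i - 1 = -(i + 1) by ring]; linarith
      · refine Or.inr ⟨-i - 1, by omega, by omega, ?_, ?_⟩
        · rw [show -i - 1 = -(i + 1) by ring]; linarith
        · rw [show -i - 1 + 1 = -i by ring]; linarith

/-- A set that is a staircase for suitable data. -/
def Staircase (S : Set (ℝ × ℝ)) : Prop :=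
  ∃ (x y : ℤ → ℝ) (a b c d : ℤ), IsStaircase S x y a b c d

theorem Staircase.swap {S : Set (ℝ × ℝ)} (h : Staircase S) : Staircase (Prod.swap ⁻¹' S) := by
  obtain ⟨x, y, a, b, c, d, h⟩ := h
  exact ⟨_, _, _, _, _, _, h.swap⟩

theorem Staircase.neg {S : Set (ℝ × ℝ)} (h : Staircase S) : Staircase (Neg.neg ⁻¹' S) := by
  obtain ⟨x, y, a, b, c, d, h⟩ := h
  exact ⟨_, _, _, _, _, _, h.neg⟩

/-- A strictly falling pair can only be the diagonal of one box: comparing the indices leaves no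
other combination. -/
theorem IsStaircase.exists_index {S : Set (ℝ × ℝ)} {x y : ℤ → ℝ} {a b c d : ℤ}
    (h : IsStaircase S x y a b c d) {V W : ℝ × ℝ} (hV : V ∈ S) (hW : W ∈ S) (h1 : V.1 < W.1)
    (h2 : W.2 < V.2) :
    ∃ i, a ≤ i ∧ i ≤ b ∧ c ≤ i ∧ i ≤ d ∧ V = (x i, y (i + 1)) ∧ W = (x (i + 1), y i) := by
  rw [h.mem_iff] at hV hW
  rcases hV with ⟨i, hi1, hi2, rfl⟩ | ⟨i, hi1, hi2, rfl⟩ <;>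
  rcases hW with ⟨j, hj1, hj2, rfl⟩ | ⟨j, hj1, hj2, rfl⟩ <;>
  have e1 := h.strictMono_x.lt_iff_lt.1 h1 <;>
  have e2 := h.strictMono_y.lt_iff_lt.1 h2
  · omega
  · obtain rfl : i = j := by omega
    exact ⟨i, hi1, hi2, hj1, hj2, rfl, rfl⟩
  · omega
  · omega

theorem staircase_pair {V W : ℝ × ℝ} (h1 : V.1 < W.1) (h2 : W.2 < V.2) :
    Staircase {V, W} := by
  -- A single box: only indices 0 and 1 carry information, and the affine extension merely keeps the
  -- sequences strictly monotone.
  refine ⟨fun i => V.1 + i * (W.1 - V.1), fun i => W.2 + i * (V.2 - W.2), 0, 0, 0, 0,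
    fun i j hij => ?_, fun i j hij => ?_, by simp, by simp, by simp, by simp, le_rfl, le_rfl,
    le_rfl, le_rfl, fun p => ?_⟩
  · have : (i : ℝ) < j := by exact_mod_cast hij
    have := mul_lt_mul_of_pos_right this (sub_pos.2 h1)
    simpa using this
  · have : (i : ℝ) < j := by exact_mod_cast hij
    have := mul_lt_mul_of_pos_right this (sub_pos.2 h2)
    simpa using this
  · have e : ∀ (P : ℤ → Prop), (∃ i : ℤ, 0 ≤ i ∧ i ≤ 0 ∧ P i) ↔ P 0 := fun P =>
      ⟨fun ⟨i, h0, h0', hp⟩ => by rwa [le_antisymm h0' h0] at hp, fun hp => ⟨0, le_rfl, le_rfl, hp⟩⟩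
    rw [e, e, mem_insert_iff, mem_singleton_iff]
    simp

/-- No three points of the set have the same second coordinate. -/
def NoThreeHorizontal (S : Set (ℝ × ℝ)) : Prop :=
  ∀ p ∈ S, ∀ q ∈ S, ∀ r ∈ S, p.2 = q.2 → q.2 = r.2 → p = q ∨ q = r ∨ p = r

/-- If the staircase continues to the right on this line, the line already carries two points and
the new one must be among them. Otherwise the box is at the upper end, and the new point becomes the
next right-hand point. -/
theorem IsStaircase.insert_right {S : Set (ℝ × ℝ)} {x y : ℤ → ℝ} {a b c d : ℤ}
    (h : IsStaircase S x y a b c d) {i : ℤ} (hai : a ≤ i) (hib : i ≤ b) (hci : c ≤ i)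
    (hid : i ≤ d) {w : ℝ} (hw : x (i + 1) < w)
    (hS : NoThreeHorizontal (insert (w, y (i + 1)) S)) :
    Staircase (insert (w, y (i + 1)) S) := by
  have hV : (x i, y (i + 1)) ∈ S := (h.mem_iff _).2 (Or.inl ⟨i, hai, hib, rfl⟩)
  have hxi : x i < x (i + 1) := h.strictMono_x (by omega)
  by_cases hd : i + 1 ≤ d
  · have hW : (x (i + 1 + 1), y (i + 1)) ∈ S :=
      (h.mem_iff _).2 (Or.inr ⟨i + 1, by omega, hd, rfl⟩)
    have hxi' : x (i + 1) < x (i + 1 + 1) := h.strictMono_x (by omega)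
    have hmem : (w, y (i + 1)) ∈ S := by
      rcases hS _ (mem_insert _ _) _ (mem_insert_of_mem _ hV) _ (mem_insert_of_mem _ hW) rfl rfl
        with e | e | e
      · rwa [e]
      · have := congrArg Prod.fst e
        simp only at this
        linarith
      · rwa [e]
    rw [insert_eq_of_mem hmem]
    exact ⟨x, y, a, b, c, d, h⟩
  · obtain rfl : i = d := by omega
    -- The existing points use `x` only up to index `i + 1`, so the values beyond may be replaced,
    -- with `w` at `i + 2`.
    let x' : ℤ → ℝ := fun j => if j ≤ i + 1 then x j else w + ((j : ℝ) - (i + 2))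
    have hx' : ∀ j ≤ i + 1, x' j = x j := fun j hj => if_pos hj
    have hx'2 : x' (i + 1 + 1) = w := by
      simp only [x']
      rw [if_neg (by omega)]
      push_cast
      ring
    have hmono : StrictMono x' := by
      intro j k hjk
      have hjk' : (j : ℝ) < k := by exact_mod_cast hjk
      simp only [x']
      split_ifs with h1 h2 h2
      · exact h.strictMono_x hjk
      · have e1 := h.strictMono_x.monotone h1
        have e2 : ((i : ℝ) + 2) ≤ k := by exact_mod_cast (by omega : i + 2 ≤ k)
        linarith
      · omega
      · linarith
    have hb := h.right_le
    refine ⟨x', y, a, b, c, i + 1, hmono, h.strictMono_y, h.left_le, h.left_ge, by omega,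
      by omega, h.ab, by omega, h.cb, by omega, fun p => ?_⟩
    rw [mem_insert_iff, h.mem_iff]
    constructor
    · rintro (rfl | ⟨j, h1, h2, rfl⟩ | ⟨j, h1, h2, rfl⟩)
      · exact Or.inr ⟨i + 1, by omega, le_rfl, by rw [hx'2]⟩
      · exact Or.inl ⟨j, h1, h2, by rw [hx' j (by omega)]⟩
      · exact Or.inr ⟨j, h1, by omega, by rw [hx' (j + 1) (by omega)]⟩
    · rintro (⟨j, h1, h2, rfl⟩ | ⟨j, h1, h2, rfl⟩)
      · exact Or.inr (Or.inl ⟨j, h1, h2, by rw [hx' j (by omega)]⟩)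
      · rcases h2.lt_or_eq with h2 | rfl
        · exact Or.inr (Or.inr ⟨j, h1, by omega, by rw [hx' (j + 1) (by omega)]⟩)
        · exact Or.inl (by rw [hx'2])

theorem Staircase.insert_right {S : Set (ℝ × ℝ)} (h : Staircase S) {V W w : ℝ × ℝ} (hV : V ∈ S)
    (hW : W ∈ S) (h1 : V.1 < W.1) (h2 : W.2 < V.2) (hw1 : W.1 < w.1) (hw2 : w.2 = V.2)
    (hS : NoThreeHorizontal (insert w S)) : Staircase (insert w S) := by
  obtain ⟨x, y, a, b, c, d, h⟩ := h
  obtain ⟨i, hi1, hi2, hi3, hi4, rfl, rfl⟩ := h.exists_index hV hW h1 h2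
  obtain ⟨w1, w2⟩ := w
  simp only at hw1 hw2
  subst hw2
  exact h.insert_right hi1 hi2 hi3 hi4 hw1 hS

theorem NoThreeHorizontal.neg {S : Set (ℝ × ℝ)} (h : NoThreeHorizontal S) :
    NoThreeHorizontal (Neg.neg ⁻¹' S) := by
  intro p hp q hq r hr hpq hqr
  have := h (-p) hp (-q) hq (-r) hr (by simp [hpq]) (by simp [hqr])
  simpa using this

theorem neg_preimage_insert (w : ℝ × ℝ) (S : Set (ℝ × ℝ)) :
    Neg.neg ⁻¹' (insert w S) = insert (-w) (Neg.neg ⁻¹' S : Set (ℝ × ℝ)) := by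
  ext p
  simp

theorem neg_preimage_neg_preimage (S : Set (ℝ × ℝ)) :
    (Neg.neg ⁻¹' (Neg.neg ⁻¹' S) : Set (ℝ × ℝ)) = S := by
  ext p
  simp

theorem swap_preimage_insert (w : ℝ × ℝ) (S : Set (ℝ × ℝ)) :
    Prod.swap ⁻¹' (insert w S) = insert w.swap (Prod.swap ⁻¹' S : Set (ℝ × ℝ)) := by
  ext ⟨p, q⟩
  obtain ⟨u, v⟩ := w
  simp [and_comm]

theorem swap_preimage_swap_preimage (S : Set (ℝ × ℝ)) :
    (Prod.swap ⁻¹' (Prod.swap ⁻¹' S) : Set (ℝ × ℝ)) = S := by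
  ext p
  simp

theorem Staircase.insert_horizontal {S : Set (ℝ × ℝ)} (h : Staircase S) {V W w : ℝ × ℝ}
    (hV : V ∈ S) (hW : W ∈ S) (hVW : (W.1 - V.1) * (W.2 - V.2) < 0)
    (hw1 : 0 < (w.1 - W.1) * (W.1 - V.1)) (hw2 : w.2 = V.2)
    (hS : NoThreeHorizontal (insert w S)) : Staircase (insert w S) := by
  rcases mul_neg_iff.1 hVW with ⟨h1, h2⟩ | ⟨h1, h2⟩
  · exact h.insert_right hV hW (by linarith) (by linarith)
      (by have := pos_of_mul_pos_left hw1 h1.le; linarith) hw2 hS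
  · have key := h.neg.insert_right (V := -V) (W := -W) (w := -w) (by simpa) (by simpa)
      (by simp only [Prod.fst_neg]; linarith) (by simp only [Prod.snd_neg]; linarith)
      (by
        have := neg_of_mul_pos_left hw1 h1.le
        simp only [Prod.fst_neg]
        linarith)
      (by simp [hw2]) (by rw [← neg_preimage_insert]; exact hS.neg)
    rw [← neg_preimage_insert] at key
    have := key.neg
    rwa [neg_preimage_neg_preimage] at this

/-- Neither coordinate takes the same value at three points of the set. -/
def NoThreeAxial (S : Set (ℝ × ℝ)) : Prop :=
  NoThreeHorizontal S ∧ NoThreeHorizontal (Prod.swap ⁻¹' S)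

theorem NoThreeAxial.mono {S T : Set (ℝ × ℝ)} (h : NoThreeAxial T) (hST : S ⊆ T) :
    NoThreeAxial S :=
  ⟨fun p hp q hq r hr => h.1 p (hST hp) q (hST hq) r (hST hr),
    fun p hp q hq r hr => h.2 p (hST hp) q (hST hq) r (hST hr)⟩

/-- `w` shares a coordinate with `V` and lies beyond `W` in the other one. -/
def IsPole (V W w : ℝ × ℝ) : Prop :=
  (w.2 = V.2 ∧ 0 < (w.1 - W.1) * (W.1 - V.1)) ∨ (w.1 = V.1 ∧ 0 < (w.2 - W.2) * (W.2 - V.2))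

theorem Staircase.insert_pole {S : Set (ℝ × ℝ)} (h : Staircase S) {V W w : ℝ × ℝ}
    (hV : V ∈ S) (hW : W ∈ S) (hVW : (W.1 - V.1) * (W.2 - V.2) < 0) (hw : IsPole V W w)
    (hS : NoThreeAxial (insert w S)) : Staircase (insert w S) := by
  rcases hw with ⟨h1, h2⟩ | ⟨h1, h2⟩
  · exact h.insert_horizontal hV hW hVW h2 h1 hS.1
  · have key := h.swap.insert_horizontal (V := V.swap) (W := W.swap) (w := w.swap) (by simpa)
      (by simpa) (by simpa [mul_comm] using hVW) (by simpa using h2) (by simpa using h1)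
      (by rw [← swap_preimage_insert]; exact hS.2)
    rw [← swap_preimage_insert] at key
    have := key.swap
    rwa [swap_preimage_swap_preimage] at this

/-- The planar image of a basic block: relative to any compatible pair that is not rank-one
compatible, and there is one, the other points are poles. -/
structure IsPoleBlock (B : Set (ℝ × ℝ)) : Prop where
  exists_pair : ∃ V ∈ B, ∃ W ∈ B, (W.1 - V.1) * (W.2 - V.2) < 0
  pole : ∀ V ∈ B, ∀ W ∈ B, (W.1 - V.1) * (W.2 - V.2) < 0 →
    ∀ w ∈ B, w = V ∨ w = W ∨ IsPole V W w ∨ IsPole W V w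

/-- The points of the block enter one at a time, all as poles of the same shared pair, which stays a
box diagonal throughout. -/
theorem Staircase.union_poleBlock {S B : Set (ℝ × ℝ)} (h : Staircase S) (hB : IsPoleBlock B)
    (hfin : B.Finite) {V W : ℝ × ℝ} (hVS : V ∈ S) (hWS : W ∈ S) (hVB : V ∈ B) (hWB : W ∈ B)
    (hVW : (W.1 - V.1) * (W.2 - V.2) < 0) (hS : NoThreeAxial (S ∪ B)) : Staircase (S ∪ B) := by
  have hWV : (V.1 - W.1) * (V.2 - W.2) < 0 := by linarith
  refine hfin.induction_on_subset (motive := fun D _ => Staircase (S ∪ D)) B (by simpa using h) ?_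
  intro w D hw hD _ ih
  rw [union_insert]
  have hS' : NoThreeAxial (insert w (S ∪ D)) :=
    hS.mono (insert_subset (Or.inr hw) (union_subset_union_right S hD))
  rcases hB.pole V hVB W hWB hVW w hw with rfl | rfl | hp | hp
  · rwa [insert_eq_of_mem (mem_union_left D hVS)]
  · rwa [insert_eq_of_mem (mem_union_left D hWS)]
  · exact ih.insert_pole (Or.inl hVS) (Or.inl hWS) hVW hp hS'
  · exact ih.insert_pole (Or.inl hWS) (Or.inl hVS) hWV hp hS'

theorem IsPoleBlock.staircase {B : Set (ℝ × ℝ)} (hB : IsPoleBlock B) (hfin : B.Finite)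
    (hS : NoThreeAxial B) : Staircase B := by
  obtain ⟨V, hV, W, hW, hVW⟩ := hB.exists_pair
  have hsub : {V, W} ⊆ B := insert_subset hV (singleton_subset_iff.2 hW)
  have h : Staircase {V, W} := by
    rcases mul_neg_iff.1 hVW with ⟨h1, h2⟩ | ⟨h1, h2⟩
    · exact staircase_pair (by linarith) (by linarith)
    · rw [pair_comm]
      exact staircase_pair (by linarith) (by linarith)
  have e : {V, W} ∪ B = B := union_eq_self_of_subset_left hsub
  have := h.union_poleBlock hB hfin (by simp) (by simp) hV hW hVW (by rwa [e])
  rwa [e] at this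

theorem staircase_iUnion_poleBlock {B : ℕ → Set (ℝ × ℝ)} {n : ℕ} (hB : ∀ i ≤ n, IsPoleBlock (B i))
    (hfin : ∀ i ≤ n, (B i).Finite)
    (hpair : ∀ i < n, ∃ V W : ℝ × ℝ, V ∈ B i ∧ W ∈ B i ∧ V ∈ B (i + 1) ∧ W ∈ B (i + 1) ∧
      (W.1 - V.1) * (W.2 - V.2) < 0)
    (hS : NoThreeAxial (⋃ i ∈ Finset.range (n + 1), B i)) :
    Staircase (⋃ i ∈ Finset.range (n + 1), B i) := by
  have key : ∀ k ≤ n, Staircase (⋃ i ∈ Finset.range (k + 1), B i) := by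
    intro k
    induction k with
    | zero =>
      intro _
      have h0 : (⋃ i ∈ Finset.range (0 + 1), B i) = B 0 := by simp
      rw [h0]
      refine (hB 0 (by omega)).staircase (hfin 0 (by omega)) (hS.mono ?_)
      exact subset_biUnion_of_mem (u := B) (Finset.mem_range.2 (by omega) : 0 ∈ Finset.range (n + 1))
    | succ k ih =>
      intro hk
      have e : (⋃ i ∈ Finset.range (k + 1 + 1), B i)
          = (⋃ i ∈ Finset.range (k + 1), B i) ∪ B (k + 1) := by
        rw [Finset.range_add_one, Finset.set_biUnion_insert, union_comm]
      obtain ⟨V, W, hV, hW, hV', hW', hVW⟩ := hpair k (by omega)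
      have hmem : ∀ p ∈ B k, p ∈ ⋃ i ∈ Finset.range (k + 1), B i := fun p hp =>
        mem_biUnion (Finset.mem_range.2 (by omega) : k ∈ Finset.range (k + 1)) hp
      rw [e]
      refine (ih (by omega)).union_poleBlock (hB _ hk) (hfin _ hk) (hmem V hV) (hmem W hW) hV' hW'
        hVW (hS.mono ?_)
      rw [← e]
      refine biUnion_subset_biUnion_left fun i hi => ?_
      have hi' := Finset.mem_range.1 hi
      exact Finset.mem_range.2 (by omega)
  exact key n le_rfl

/-! ### The hull of a staircase -/

/-- `z` satisfies every inequality `-c x y + α x + β y + γ ≤ 0`, `c ≥ 0`, that holds on `S`. -/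
def InPolyHull (S : Set (ℝ × ℝ)) (z : ℝ × ℝ) : Prop :=
  ∀ c α β γ : ℝ, 0 ≤ c → (∀ u ∈ S, -c * (u.1 * u.2) + α * u.1 + β * u.2 + γ ≤ 0) →
    -c * (z.1 * z.2) + α * z.1 + β * z.2 + γ ≤ 0

/-- `T` contains the segments between its points whose direction is nonpositive for the form
`x y`. -/
def LamClosed (T : Set (ℝ × ℝ)) : Prop :=
  ∀ p ∈ T, ∀ q ∈ T, (p.1 - q.1) * (p.2 - q.2) ≤ 0 → ∀ t : ℝ, 0 ≤ t → t ≤ 1 →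
    t • p + (1 - t) • q ∈ T

theorem InPolyHull.neg {S : Set (ℝ × ℝ)} {z : ℝ × ℝ} (h : InPolyHull S z) :
    InPolyHull (Neg.neg ⁻¹' S) (-z) := by
  intro c α β γ hc hS
  have := h c (-α) (-β) γ hc fun u hu => by
    have := hS (-u) (by simpa using hu)
    simp only [Prod.fst_neg, Prod.snd_neg] at this
    linarith
  simp only [Prod.fst_neg, Prod.snd_neg]
  linarith

theorem InPolyHull.swap {S : Set (ℝ × ℝ)} {z : ℝ × ℝ} (h : InPolyHull S z) :
    InPolyHull (Prod.swap ⁻¹' S) z.swap := by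
  intro c α β γ hc hS
  have := h c β α γ hc fun u hu => by
    have := hS u.swap (by simpa using hu)
    simp only [Prod.fst_swap, Prod.snd_swap] at this
    linarith
  simp only [Prod.fst_swap, Prod.snd_swap]
  linarith

theorem LamClosed.neg {T : Set (ℝ × ℝ)} (h : LamClosed T) : LamClosed (Neg.neg ⁻¹' T) := by
  intro p hp q hq hpq t ht0 ht1
  have := h (-p) hp (-q) hq (by simp only [Prod.fst_neg, Prod.snd_neg]; linarith) t ht0 ht1
  rw [mem_preimage, neg_add, ← smul_neg, ← smul_neg]
  exact this

theorem LamClosed.swap {T : Set (ℝ × ℝ)} (h : LamClosed T) : LamClosed (Prod.swap ⁻¹' T) := by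
  intro p hp q hq hpq t ht0 ht1
  exact h p.swap hp q.swap hq (by simp only [Prod.fst_swap, Prod.snd_swap]; linarith) t ht0 ht1

theorem LamClosed.horizontal {T : Set (ℝ × ℝ)} (h : LamClosed T) {p q s y : ℝ} (hp : (p, y) ∈ T)
    (hq : (q, y) ∈ T) (hps : p ≤ s) (hsq : s ≤ q) : (s, y) ∈ T := by
  rcases (hps.trans hsq).eq_or_lt with rfl | hpq
  · rwa [le_antisymm hsq hps]
  · have hpos : 0 < q - p := sub_pos.2 hpq
    have := h _ hp _ hq (by simp) ((q - s) / (q - p)) (div_nonneg (by linarith) hpos.le)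
      ((div_le_one hpos).2 (by linarith))
    convert this using 1
    ext
    · simp
      field_simp
      ring
    · simp
      ring

theorem LamClosed.vertical {T : Set (ℝ × ℝ)} (h : LamClosed T) {p q s x : ℝ} (hp : (x, p) ∈ T)
    (hq : (x, q) ∈ T) (hps : p ≤ s) (hsq : s ≤ q) : (x, s) ∈ T :=
  h.swap.horizontal (p := p) (q := q) (s := s) (y := x) hp hq hps hsq

/-- The two legs are axis-parallel, hence in `T`. The point with barycentric weights `r`, `s` lies
on the parallel to the hypotenuse that joins the points at fraction `r + s` of the legs, and this
direction is admissible too. -/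
theorem LamClosed.triangle {T : Set (ℝ × ℝ)} (h : LamClosed T) {C X Y : ℝ × ℝ} (hC : C ∈ T)
    (hX : X ∈ T) (hY : Y ∈ T) (hCX : X.1 = C.1) (hCY : Y.2 = C.2)
    (hXY : 0 ≤ (Y.1 - C.1) * (X.2 - C.2)) {r s : ℝ} (hr : 0 ≤ r) (hs : 0 ≤ s) (hrs : r + s ≤ 1) :
    (C.1 + s * (Y.1 - C.1), C.2 + r * (X.2 - C.2)) ∈ T := by
  rcases (add_nonneg hr hs).eq_or_lt with h0 | hpos
  · obtain rfl : r = 0 := by linarith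
    obtain rfl : s = 0 := by linarith
    simpa using hC
  · have hp := h X hX C hC (by rw [hCX]; simp) (r + s) hpos.le hrs
    have hq := h Y hY C hC (by rw [hCY]; simp) (r + s) hpos.le hrs
    have := h _ hp _ hq (by
      simp only [Prod.fst_add, Prod.snd_add, Prod.smul_fst, Prod.smul_snd, smul_eq_mul, hCX, hCY]
      have e := mul_nonneg (mul_self_nonneg (r + s)) hXY
      linarith) (r / (r + s)) (div_nonneg hr hpos.le) ((div_le_one hpos).2 (by linarith))
    convert this using 1
    ext
    · simp only [Prod.fst_add, Prod.smul_fst, smul_eq_mul, hCX]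
      field_simp
      ring
    · simp only [Prod.snd_add, Prod.smul_snd, smul_eq_mul, hCY]
      field_simp
      ring

namespace IsStaircase

variable {S T : Set (ℝ × ℝ)} {x y : ℤ → ℝ} {a b c d : ℤ} {z : ℝ × ℝ}

theorem mem_left (h : IsStaircase S x y a b c d) {i : ℤ} (h1 : a ≤ i) (h2 : i ≤ b) :
    (x i, y (i + 1)) ∈ S := (h.mem_iff _).2 (Or.inl ⟨i, h1, h2, rfl⟩)

theorem mem_right (h : IsStaircase S x y a b c d) {i : ℤ} (h1 : c ≤ i) (h2 : i ≤ d) :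
    (x (i + 1), y i) ∈ S := (h.mem_iff _).2 (Or.inr ⟨i, h1, h2, rfl⟩)

/-- Each point of the staircase lies weakly above or weakly below the corner in both coordinates.
This is the only place where the determinant enters the test functions for a staircase. -/
theorem mul_nonneg_corner (h : IsStaircase S x y a b c d) (hz : InPolyHull S z) (j : ℤ) :
    0 ≤ (z.1 - x j) * (z.2 - y j) := by
  have := hz 1 (y j) (x j) (-(x j * y j)) zero_le_one fun u hu => by
    suffices 0 ≤ (u.1 - x j) * (u.2 - y j) by linarith
    rw [h.mem_iff] at hu
    rcases hu with ⟨i, -, -, rfl⟩ | ⟨i, -, -, rfl⟩ <;> rcases lt_or_ge i j with hij | hij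
    · exact mul_nonneg_of_nonpos_of_nonpos
        (sub_nonpos.2 (h.strictMono_x.monotone (by omega)))
        (sub_nonpos.2 (h.strictMono_y.monotone (by omega)))
    · exact mul_nonneg (sub_nonneg.2 (h.strictMono_x.monotone (by omega)))
        (sub_nonneg.2 (h.strictMono_y.monotone (by omega)))
    · exact mul_nonneg_of_nonpos_of_nonpos
        (sub_nonpos.2 (h.strictMono_x.monotone (by omega)))
        (sub_nonpos.2 (h.strictMono_y.monotone (by omega)))
    · exact mul_nonneg (sub_nonneg.2 (h.strictMono_x.monotone (by omega)))
        (sub_nonneg.2 (h.strictMono_y.monotone (by omega)))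
  linarith

theorem fst_le (h : IsStaircase S x y a b c d) (hz : InPolyHull S z) {n : ℤ} (hb : b ≤ n)
    (hd : d + 1 ≤ n) : z.1 ≤ x n := by
  have := hz 0 1 0 (-x n) le_rfl fun u hu => by
    suffices u.1 ≤ x n by linarith
    rw [h.mem_iff] at hu
    rcases hu with ⟨i, -, h2, rfl⟩ | ⟨i, -, h2, rfl⟩
    · exact h.strictMono_x.monotone (by omega)
    · exact h.strictMono_x.monotone (by omega)
  linarith

theorem snd_le (h : IsStaircase S x y a b c d) (hz : InPolyHull S z) {n : ℤ} (hb : b + 1 ≤ n)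
    (hd : d ≤ n) : z.2 ≤ y n :=
  h.swap.fst_le hz.swap hd hb

/-- Past the last corner, the corner inequality and the bound on the second coordinate leave only
the horizontal segment that ends at the extra well. -/
theorem le_corner_or_mem_aux (h : IsStaircase S x y a b c d) (hz : InPolyHull S z)
    (hT : LamClosed T) (hST : S ⊆ T) (hbd : b ≤ d) :
    (z.1 ≤ x (b + 1) ∧ z.2 ≤ y (b + 1)) ∨ z ∈ T := by
  have h2 : z.2 ≤ y (b + 1) := h.snd_le hz le_rfl h.right_ge
  rcases le_or_gt z.1 (x (b + 1)) with h1 | h1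
  · exact Or.inl ⟨h1, h2⟩
  · right
    have hcorner := h.mul_nonneg_corner hz (b + 1)
    have h2' : z.2 = y (b + 1) :=
      le_antisymm h2 (sub_nonneg.1 (nonneg_of_mul_nonneg_right hcorner (sub_pos.2 h1)))
    rcases hbd.eq_or_lt with rfl | hbd
    · exact absurd (h.fst_le hz (by omega) le_rfl) (not_le.2 h1)
    · have hdb := h.right_ge
      obtain rfl : d = b + 1 := by omega
      have hz1 : z.1 ≤ x (b + 1 + 1) := h.fst_le hz (by omega) le_rfl
      have e1 := hST (h.mem_left h.ab le_rfl)
      have e2 := hST (h.mem_right h.cd le_rfl)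
      have hx : x b < x (b + 1) := h.strictMono_x (by omega)
      have := hT.horizontal e1 e2 (by linarith) hz1
      rwa [← h2'] at this

theorem le_corner_or_mem (h : IsStaircase S x y a b c d) (hz : InPolyHull S z)
    (hT : LamClosed T) (hST : S ⊆ T) :
    (z.1 ≤ x (min b d + 1) ∧ z.2 ≤ y (min b d + 1)) ∨ z ∈ T := by
  rcases le_total b d with hbd | hbd
  · rw [min_eq_left hbd]
    exact h.le_corner_or_mem_aux hz hT hST hbd
  · rw [min_eq_right hbd]
    have := h.swap.le_corner_or_mem_aux hz.swap hT.swap (preimage_mono hST) hbd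
    simpa [and_comm] using this

theorem corner_le_or_mem (h : IsStaircase S x y a b c d) (hz : InPolyHull S z)
    (hT : LamClosed T) (hST : S ⊆ T) :
    (x (max a c) ≤ z.1 ∧ y (max a c) ≤ z.2) ∨ z ∈ T := by
  have := h.neg.le_corner_or_mem hz.neg hT.neg (preimage_mono hST)
  have e : -(min (-c - 1) (-a - 1) + 1) = max a c := by omega
  simpa [e] using this

/-- If there is a well of index `i + 1`, the upper corner lies between it and a well of the box on a
common axis-parallel line. -/
theorem upper_corner_mem_or (h : IsStaircase S x y a b c d) (hz : InPolyHull S z)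
    (hT : LamClosed T) (hST : S ⊆ T) {i : ℤ} (hai : a ≤ i) (hib : i ≤ b) (hci : c ≤ i)
    (hid : i ≤ d) :
    (x (i + 1), y (i + 1)) ∈ T ∨
      (z.1 - x i) * (y (i + 1) - y i) + (z.2 - y (i + 1)) * (x (i + 1) - x i) ≤ 0 := by
  by_cases hd : i + 1 ≤ d
  · exact Or.inl (hT.horizontal (hST (h.mem_left hai hib)) (hST (h.mem_right (by omega) hd))
      (h.strictMono_x.monotone (by omega)) (h.strictMono_x.monotone (by omega)))
  by_cases hb : i + 1 ≤ b
  · exact Or.inl (hT.vertical (hST (h.mem_right hci hid)) (hST (h.mem_left (by omega) hb))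
      (h.strictMono_y.monotone (by omega)) (h.strictMono_y.monotone (by omega)))
  -- No well has index `i + 1`: this is the last box, and the line through its falling diagonal has
  -- all of `S` on one side.
  right
  have hx : 0 < x (i + 1) - x i := sub_pos.2 (h.strictMono_x (by omega))
  have hy : 0 < y (i + 1) - y i := sub_pos.2 (h.strictMono_y (by omega))
  have := hz 0 (y (i + 1) - y i) (x (i + 1) - x i)
    (-(x i * (y (i + 1) - y i)) - y (i + 1) * (x (i + 1) - x i)) le_rfl fun u hu => by
      rw [h.mem_iff] at hu
      rcases hu with ⟨j, -, h2, rfl⟩ | ⟨j, -, h2, rfl⟩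
      · have e1 : x j ≤ x i := h.strictMono_x.monotone (by omega)
        have e2 : y (j + 1) ≤ y (i + 1) := h.strictMono_y.monotone (by omega)
        have e3 := mul_le_mul_of_nonneg_right e1 hy.le
        have e4 := mul_le_mul_of_nonneg_right e2 hx.le
        simp only
        linarith
      · have e1 : x (j + 1) ≤ x (i + 1) := h.strictMono_x.monotone (by omega)
        have e2 : y j ≤ y i := h.strictMono_y.monotone (by omega)
        have e3 := mul_le_mul_of_nonneg_right e1 hy.le
        have e4 := mul_le_mul_of_nonneg_right e2 hx.le
        simp only
        linarith
  linarith

theorem lower_corner_mem_or (h : IsStaircase S x y a b c d) (hz : InPolyHull S z)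
    (hT : LamClosed T) (hST : S ⊆ T) {i : ℤ} (hai : a ≤ i) (hib : i ≤ b) (hci : c ≤ i)
    (hid : i ≤ d) :
    (x i, y i) ∈ T ∨
      0 ≤ (z.1 - x i) * (y (i + 1) - y i) + (z.2 - y (i + 1)) * (x (i + 1) - x i) := by
  have := h.neg.upper_corner_mem_or hz.neg hT.neg (preimage_mono hST) (i := -i - 1) (by omega)
    (by omega) (by omega) (by omega)
  have e1 : -(-i - 1 + 1) = i := by ring
  have e2 : -(-i - 1) = i + 1 := by ring
  simp only [e1, e2, mem_preimage, Prod.neg_mk, neg_neg, Prod.fst_neg, Prod.snd_neg] at this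
  refine this.imp_right fun h => ?_
  linarith

theorem mem_of_mem_box (h : IsStaircase S x y a b c d) (hz : InPolyHull S z) (hT : LamClosed T)
    (hST : S ⊆ T) {i : ℤ} (hai : a ≤ i) (hib : i ≤ b) (hci : c ≤ i) (hid : i ≤ d)
    (hx0 : x i ≤ z.1) (hx1 : z.1 ≤ x (i + 1)) (hy0 : y i ≤ z.2) (hy1 : z.2 ≤ y (i + 1)) :
    z ∈ T := by
  have hx : 0 < x (i + 1) - x i := sub_pos.2 (h.strictMono_x (by omega))
  have hy : 0 < y (i + 1) - y i := sub_pos.2 (h.strictMono_y (by omega))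
  have hX := hST (h.mem_left hai hib)
  have hY := hST (h.mem_right hci hid)
  -- The sign of `L` tells on which side of the falling diagonal `z` lies. Off the diagonal, the
  -- corner on that side must be in `T`, since the alternative inequality fails at `z`.
  set L := (z.1 - x i) * (y (i + 1) - y i) + (z.2 - y (i + 1)) * (x (i + 1) - x i) with hL
  rcases lt_trichotomy L 0 with hneg | h0 | hpos
  · have hC := (h.lower_corner_mem_or hz hT hST hai hib hci hid).resolve_right (not_le.2 hneg)
    have := hT.triangle hC hX hY rfl rfl (mul_pos hx hy).le
      (r := (z.2 - y i) / (y (i + 1) - y i)) (s := (z.1 - x i) / (x (i + 1) - x i))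
      (div_nonneg (by linarith) hy.le) (div_nonneg (by linarith) hx.le) (by
        rw [div_add_div _ _ hy.ne' hx.ne', div_le_one (mul_pos hy hx)]
        linarith)
    simpa [div_mul_cancel₀ _ hx.ne', div_mul_cancel₀ _ hy.ne'] using this
  · have := hT _ hX _ hY (by
      have := mul_pos hx hy
      simp only
      linarith) ((z.2 - y i) / (y (i + 1) - y i)) (div_nonneg (by linarith) hy.le)
      ((div_le_one hy).2 (by linarith))
    convert this using 1
    ext
    · simp only [Prod.fst_add, Prod.smul_fst, smul_eq_mul]
      field_simp
      linarith
    · simp only [Prod.snd_add, Prod.smul_snd, smul_eq_mul]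
      field_simp
      ring
  · have hC := (h.upper_corner_mem_or hz hT hST hai hib hci hid).resolve_right (not_le.2 hpos)
    have := hT.triangle hC hY hX rfl rfl (by
        have := mul_pos hx hy
        simp only
        linarith)
      (r := (y (i + 1) - z.2) / (y (i + 1) - y i)) (s := (x (i + 1) - z.1) / (x (i + 1) - x i))
      (div_nonneg (by linarith) hy.le) (div_nonneg (by linarith) hx.le) (by
        rw [div_add_div _ _ hy.ne' hx.ne', div_le_one (mul_pos hy hx)]
        linarith)
    convert this using 1
    ext
    · simp only
      field_simp
      ring
    · simp only
      field_simp
      ring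

/-- The corner inequality puts `z` weakly above or weakly below each corner; the box lies where the
comparison switches. -/
theorem exists_box (h : IsStaircase S x y a b c d) (hz : InPolyHull S z) (m : ℤ) (n : ℕ)
    (h0 : x m ≤ z.1 ∧ y m ≤ z.2) (h1 : z.1 ≤ x (m + n + 1) ∧ z.2 ≤ y (m + n + 1)) :
    ∃ i, m ≤ i ∧ i ≤ m + n ∧ (x i ≤ z.1 ∧ y i ≤ z.2) ∧ z.1 ≤ x (i + 1) ∧ z.2 ≤ y (i + 1) := by
  induction n with
  | zero => exact ⟨m, le_rfl, by simp, h0, by simpa using h1⟩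
  | succ n ih =>
    have hcorner := h.mul_nonneg_corner hz (m + n + 1)
    rcases mul_nonneg_iff.1 hcorner with ⟨e1, e2⟩ | ⟨e1, e2⟩
    · refine ⟨m + n + 1, by omega, by push_cast; omega, ⟨by linarith, by linarith⟩, ?_⟩
      have e : m + ((n + 1 : ℕ) : ℤ) + 1 = m + n + 1 + 1 := by push_cast; ring
      rwa [e] at h1
    · obtain ⟨i, h2, h3, h4⟩ := ih ⟨by linarith, by linarith⟩
      exact ⟨i, h2, by push_cast; omega, h4⟩

theorem mem_of_inPolyHull (h : IsStaircase S x y a b c d) (hz : InPolyHull S z)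
    (hT : LamClosed T) (hST : S ⊆ T) : z ∈ T := by
  rcases h.corner_le_or_mem hz hT hST with h0 | h0
  swap; · exact h0
  rcases h.le_corner_or_mem hz hT hST with h1 | h1
  swap; · exact h1
  have hab := h.ab
  have had := h.ad
  have hcb := h.cb
  have hcd := h.cd
  obtain ⟨n, hn⟩ := Int.eq_ofNat_of_zero_le (a := min b d - max a c) (by omega)
  have e : min b d + 1 = max a c + n + 1 := by omega
  rw [e] at h1
  obtain ⟨i, hi1, hi2, ⟨h2, h3⟩, h4, h5⟩ := h.exists_box hz (max a c) n h0 h1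
  exact h.mem_of_mem_box hz hT hST (by omega) (by omega) (by omega) (by omega) h2 h4 h3 h5

end IsStaircase

/-! ### Planar images of basic blocks -/

/-- `Z` shares a coordinate with `X`. Multiplying the two strict sign conditions gives a square
times the product that says `Z` lies beyond `Y` in the other coordinate. -/
theorem isPoleBlock_flag {X Y Z : ℝ × ℝ} (hXY : (X.1 - Y.1) * (X.2 - Y.2) < 0)
    (hXZ : (X.1 - Z.1) * (X.2 - Z.2) = 0) (hYZ : 0 < (Y.1 - Z.1) * (Y.2 - Z.2)) :
    IsPoleBlock {X, Y, Z} := by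
  have hpole : IsPole X Y Z := by
    rcases mul_eq_zero.1 hXZ with h | h
    · refine Or.inr ⟨by linarith, ?_⟩
      have e : Z.1 = X.1 := by linarith
      rw [e] at hYZ
      have := mul_pos_of_neg_of_neg (neg_lt_zero.2 hYZ) hXY
      have h' : 0 < (X.1 - Y.1) ^ 2 * ((Z.2 - Y.2) * (Y.2 - X.2)) := by linarith
      exact pos_of_mul_pos_right h' (sq_nonneg _)
    · refine Or.inl ⟨by linarith, ?_⟩
      have e : Z.2 = X.2 := by linarith
      rw [e] at hYZ
      have := mul_pos_of_neg_of_neg (neg_lt_zero.2 hYZ) hXY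
      have h' : 0 < (X.2 - Y.2) ^ 2 * ((Z.1 - Y.1) * (Y.1 - X.1)) := by linarith
      exact pos_of_mul_pos_right h' (sq_nonneg _)
  refine ⟨⟨X, by simp, Y, by simp, by linarith⟩, ?_⟩
  intro V hV W hW hVW w hw
  simp only [mem_insert_iff, mem_singleton_iff] at hV hW hw
  rcases hV with rfl | rfl | rfl <;> rcases hW with rfl | rfl | rfl <;>
    first
      | (exfalso; linarith)
      | (rcases hw with rfl | rfl | rfl
         · simp
         · simp
         · simp [hpole])

theorem IsPoleBlock.swap {B : Set (ℝ × ℝ)} (hB : IsPoleBlock B) :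
    IsPoleBlock (Prod.swap ⁻¹' B) := by
  obtain ⟨⟨V, hV, W, hW, hVW⟩, hp⟩ := hB
  refine ⟨⟨V.swap, by simpa, W.swap, by simpa, by simpa [mul_comm] using hVW⟩, ?_⟩
  intro V hV W hW hVW w hw
  rcases hp V.swap hV W.swap hW (by simpa [mul_comm] using hVW) w.swap hw with h | h | h | h
  · exact Or.inl (Prod.swap_injective h)
  · exact Or.inr (Or.inl (Prod.swap_injective h))
  · exact Or.inr (Or.inr (Or.inl h.symm))
  · exact Or.inr (Or.inr (Or.inr h.symm))

/-- A falling pair takes one end from each bar, and since the bars cross strictly inside, the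
opposite ends are its poles. -/
theorem isPoleBlock_cross_of_axes {p₁ p₂ q₁ q₂ x y : ℝ} (hp : 0 < (p₂ - x) * (x - p₁))
    (hq : 0 < (q₂ - y) * (y - q₁)) :
    IsPoleBlock {(p₁, y), (p₂, y), (x, q₁), (x, q₂)} := by
  have hp' : 0 < (p₁ - x) * (x - p₂) := by linarith
  have hq' : 0 < (q₁ - y) * (y - q₂) := by linarith
  refine ⟨?_, ?_⟩
  · have hprod := mul_pos hp hq
    rcases lt_trichotomy ((x - p₁) * (q₁ - y)) 0 with h | h | h
    · exact ⟨(p₁, y), by simp, (x, q₁), by simp, h⟩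
    · rcases mul_eq_zero.1 h with h | h
      · rw [h, mul_zero] at hp
        exact absurd hp (lt_irrefl _)
      · rw [h, zero_mul] at hq'
        exact absurd hq' (lt_irrefl _)
    · refine ⟨(p₂, y), by simp, (x, q₁), by simp, ?_⟩
      have e := mul_pos hp h
      have e' : 0 < (x - p₁) ^ 2 * ((p₂ - x) * (q₁ - y)) := by linarith
      have := pos_of_mul_pos_right e' (sq_nonneg _)
      simp only
      linarith
  · intro V hV W hW hVW w hw
    simp only [mem_insert_iff, mem_singleton_iff] at hV hW hw
    rcases hV with rfl | rfl | rfl | rfl <;> rcases hW with rfl | rfl | rfl | rfl <;>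
      first
        | (exfalso; simp at hVW; done)
        | (rcases hw with rfl | rfl | rfl | rfl <;> simp [IsPole, hp, hp', hq, hq'])

theorem NoThreeHorizontal.ne {S : Set (ℝ × ℝ)} (h : NoThreeHorizontal S) {p q r : ℝ × ℝ}
    (hp : p ∈ S) (hq : q ∈ S) (hr : r ∈ S) (hpq : p ≠ q) (hqr : q ≠ r) (hpr : p ≠ r)
    (e : p.2 = q.2) : q.2 ≠ r.2 := fun e' => by
  rcases h p hp q hq r hr e e' with h | h | h
  · exact hpq h
  · exact hqr h
  · exact hpr h

theorem isPoleBlock_cross_of_horizontal {v₁ v₂ w₁ w₂ : ℝ × ℝ}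
    (hS : NoThreeAxial {v₁, v₂, w₁, w₂}) (hv : v₁ ≠ v₂) (hw : w₁ ≠ w₂) (h11 : v₁ ≠ w₁)
    (h12 : v₁ ≠ w₂) (h21 : v₂ ≠ w₁) (h22 : v₂ ≠ w₂) (hv' : v₁.2 = v₂.2)
    (hw' : (w₁.1 - w₂.1) * (w₁.2 - w₂.2) = 0) {s r : ℝ} (hs0 : 0 ≤ s) (hs1 : s ≤ 1) (hr0 : 0 ≤ r)
    (hr1 : r ≤ 1) (hO : v₁ + s • (v₂ - v₁) = w₁ + r • (w₂ - w₁)) :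
    IsPoleBlock {v₁, v₂, w₁, w₂} := by
  have hO1 := congrArg Prod.fst hO
  have hO2 := congrArg Prod.snd hO
  simp only [Prod.fst_add, Prod.snd_add, Prod.smul_fst, Prod.smul_snd, Prod.fst_sub, Prod.snd_sub,
    smul_eq_mul] at hO1 hO2
  have nH : ∀ p ∈ ({v₁, v₂, w₁, w₂} : Set (ℝ × ℝ)), p ≠ v₁ → p ≠ v₂ → v₂.2 ≠ p.2 :=
    fun p hp h1 h2 => hS.1.ne (by simp) (by simp) hp hv h2.symm h1.symm hv'
  have hn1 := nH w₁ (by simp) h11.symm h21.symm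
  have hn2 := nH w₂ (by simp) h12.symm h22.symm
  -- Were the second bar horizontal as well, the common point would put more than two wells on one
  -- line.
  have hx : w₁.1 = w₂.1 := by
    rcases mul_eq_zero.1 hw' with h | h
    · linarith
    · exfalso
      apply hn1
      have e : w₂.2 - w₁.2 = 0 := by linarith
      rw [hv', e] at hO2
      linarith
  have nV : ∀ p ∈ ({v₁, v₂, w₁, w₂} : Set (ℝ × ℝ)), p ≠ w₁ → p ≠ w₂ → w₂.1 ≠ p.1 := by
    intro p hp h1 h2
    exact hS.2.ne (p := w₁.swap) (q := w₂.swap) (r := p.swap) (by simp) (by simp) (by simpa using hp)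
      (fun h => hw (Prod.swap_injective h)) (fun h => h2 (Prod.swap_injective h).symm)
      (fun h => h1 (Prod.swap_injective h).symm) hx
  have hm1 := nV v₁ (by simp) h11 h12
  have hm2 := nV v₂ (by simp) h21 h22
  obtain ⟨p₁, y⟩ := v₁
  obtain ⟨p₂, y'⟩ := v₂
  obtain ⟨x, q₁⟩ := w₁
  obtain ⟨x', q₂⟩ := w₂
  simp only at hv' hx hn1 hn2 hm1 hm2 hO1 hO2
  subst hv' hx
  rw [sub_self, mul_zero, add_zero] at hO1 hO2
  have between : ∀ {s p₁ p₂ x : ℝ}, 0 ≤ s → s ≤ 1 → x = p₁ + s * (p₂ - p₁) → x ≠ p₁ → x ≠ p₂ →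
      0 < (p₂ - x) * (x - p₁) := by
    intro s p₁ p₂ x h0 h1 hx hx1 hx2
    have e1 : x - p₁ = s * (p₂ - p₁) := by linarith
    have e2 : p₂ - x = (1 - s) * (p₂ - p₁) := by linarith
    have hne : (p₂ - x) * (x - p₁) ≠ 0 := mul_ne_zero (sub_ne_zero.2 hx2.symm) (sub_ne_zero.2 hx1)
    refine lt_of_le_of_ne ?_ hne.symm
    rw [e1, e2]
    have := mul_nonneg (mul_nonneg (sub_nonneg.2 h1) h0) (mul_self_nonneg (p₂ - p₁))
    linarith
  exact isPoleBlock_cross_of_axes (between hs0 hs1 hO1.symm hm1 hm2)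
    (between hr0 hr1 hO2 hn1 hn2)

theorem isPoleBlock_cross {v₁ v₂ w₁ w₂ : ℝ × ℝ}
    (hS : NoThreeAxial {v₁, v₂, w₁, w₂}) (hv : v₁ ≠ v₂) (hw : w₁ ≠ w₂) (h11 : v₁ ≠ w₁)
    (h12 : v₁ ≠ w₂) (h21 : v₂ ≠ w₁) (h22 : v₂ ≠ w₂)
    (hv' : (v₁.1 - v₂.1) * (v₁.2 - v₂.2) = 0)
    (hw' : (w₁.1 - w₂.1) * (w₁.2 - w₂.2) = 0) {s r : ℝ} (hs0 : 0 ≤ s) (hs1 : s ≤ 1) (hr0 : 0 ≤ r)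
    (hr1 : r ≤ 1) (hO : v₁ + s • (v₂ - v₁) = w₁ + r • (w₂ - w₁)) :
    IsPoleBlock {v₁, v₂, w₁, w₂} := by
  rcases mul_eq_zero.1 hv' with h | h
  · have inj := Prod.swap_injective (α := ℝ) (β := ℝ)
    have e : Prod.swap ⁻¹' ({v₁, v₂, w₁, w₂} : Set (ℝ × ℝ))
        = {v₁.swap, v₂.swap, w₁.swap, w₂.swap} := by
      simp only [swap_preimage_insert]
      congr 3
      ext ⟨p, q⟩
      obtain ⟨u, v⟩ := w₂
      simp [and_comm]
    have hS' : NoThreeAxial {v₁.swap, v₂.swap, w₁.swap, w₂.swap} := by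
      rw [← e]
      exact ⟨hS.2, by rw [swap_preimage_swap_preimage]; exact hS.1⟩
    have := isPoleBlock_cross_of_horizontal hS' (inj.ne hv) (inj.ne hw) (inj.ne h11) (inj.ne h12)
      (inj.ne h21) (inj.ne h22) (by simp only [Prod.snd_swap]; linarith)
      (by simp only [Prod.snd_swap, Prod.fst_swap]; linarith) hs0 hs1 hr0 hr1
      (congrArg Prod.swap hO)
    rw [← e] at this
    have := this.swap
    rwa [swap_preimage_swap_preimage] at this
  · exact isPoleBlock_cross_of_horizontal hS hv hw h11 h12 h21 h22 (by linarith) hw' hs0 hs1 hr0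
      hr1 hO

/-! ### Isotropic coordinates on a plane of symmetric matrices -/

theorem sum_mul_eq {Q A : Mat} (hQ : Q.IsSymm) (hA : A.IsSymm) :
    ∑ i, ∑ j, Q i j * A i j = Q 0 0 * A 0 0 + 2 * Q 0 1 * A 0 1 + Q 1 1 * A 1 1 := by
  simp only [Fin.sum_univ_two, apply_one_zero_of_isSymm hQ, apply_one_zero_of_isSymm hA]
  ring

theorem det_eq_of_isSymm {A : Mat} (hA : A.IsSymm) : A.det = A 0 0 * A 1 1 - A 0 1 ^ 2 := by
  rw [Matrix.det_fin_two, apply_one_zero_of_isSymm hA]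
  ring

theorem ext_of_isSymm {A B : Mat} (hA : A.IsSymm) (hB : B.IsSymm) (h0 : A 0 0 = B 0 0)
    (h1 : A 0 1 = B 0 1) (h2 : A 1 1 = B 1 1) : A = B := by
  ext i j
  fin_cases i <;> fin_cases j <;>
    simp [h0, h1, h2, apply_one_zero_of_isSymm hA, apply_one_zero_of_isSymm hB]

theorem isSymm_fin_two (p q r : ℝ) : (!![p, q; q, r] : Mat).IsSymm := by
  ext i j
  fin_cases i <;> fin_cases j <;> simp

/-- If `det Q ≥ 0`, the plane orthogonal to `Q` contains no matrix of positive determinant and at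
most one direction of zero determinant. -/
theorem exists_isotropic_line {Q : Mat} (hQ : Q.IsSymm) (hQ0 : Q ≠ 0) (hdet : 0 ≤ Q.det) :
    ∃ R : Mat, ∀ A : Mat, A.IsSymm → Q 0 0 * A 0 0 + 2 * Q 0 1 * A 0 1 + Q 1 1 * A 1 1 = 0 →
      A.det ≤ 0 ∧ (A.det = 0 → ∃ s : ℝ, A = s • R) := by
  rw [det_eq_of_isSymm hQ] at hdet
  by_cases h0 : Q 0 0 = 0
  · have h1 : Q 0 1 = 0 := by
      rw [h0] at hdet
      nlinarith [sq_nonneg (Q 0 1)]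
    have h2 : Q 1 1 ≠ 0 := fun h2 =>
      hQ0 (ext_of_isSymm hQ (Matrix.transpose_zero) (by simpa) (by simpa) (by simpa))
    refine ⟨!![1, 0; 0, 0], fun A hA h => ?_⟩
    have hA1 : A 1 1 = 0 := by
      rw [h0, h1] at h
      have : Q 1 1 * A 1 1 = 0 := by linarith
      exact (mul_eq_zero.1 this).resolve_left h2
    rw [det_eq_of_isSymm hA, hA1]
    refine ⟨by nlinarith [sq_nonneg (A 0 1)], fun hd => ⟨A 0 0, ?_⟩⟩
    have hA01 : A 0 1 = 0 := by nlinarith [sq_nonneg (A 0 1)]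
    exact ext_of_isSymm hA ((isSymm_fin_two 1 0 0).smul _) (by simp) (by simpa) (by simpa)
  · refine ⟨!![(Q 0 1 / Q 0 0) ^ 2, -(Q 0 1 / Q 0 0); -(Q 0 1 / Q 0 0), 1], fun A hA h => ?_⟩
    set a := Q 0 0
    set b := Q 0 1
    set c := Q 1 1
    -- Orthogonality to `Q` eliminates `A₀₀`; completing the square shows that the determinant is
    -- negative semidefinite on the plane.
    have key : a ^ 2 * A.det
        = -((a * A 0 1 + b * A 1 1) ^ 2 + (a * c - b ^ 2) * A 1 1 ^ 2) := by
      rw [det_eq_of_isSymm hA]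
      linear_combination a * A 1 1 * h
    have ha : 0 < a ^ 2 := by positivity
    have hn1 := sq_nonneg (a * A 0 1 + b * A 1 1)
    have hn2 := mul_nonneg hdet (sq_nonneg (A 1 1))
    refine ⟨nonpos_of_mul_nonpos_right (by linarith) ha, fun hd => ⟨A 1 1, ?_⟩⟩
    rw [hd, mul_zero] at key
    have e1 : a * A 0 1 + b * A 1 1 = 0 := pow_eq_zero_iff two_ne_zero |>.1 (by linarith)
    have e2 : (a * c - b ^ 2) * A 1 1 = 0 := by
      have : (a * c - b ^ 2) * A 1 1 ^ 2 = 0 := by linarith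
      rcases mul_eq_zero.1 this with h | h
      · rw [h, zero_mul]
      · rw [pow_eq_zero_iff two_ne_zero |>.1 h, mul_zero]
    refine ext_of_isSymm hA ((isSymm_fin_two _ _ _).smul _) ?_ ?_ (by simp)
    · simp only [Matrix.smul_apply, Matrix.of_apply, Matrix.cons_val_zero, smul_eq_mul]
      field_simp
      linear_combination a * h - 2 * b * e1 - e2
    · simp only [Matrix.smul_apply, Matrix.of_apply, Matrix.cons_val_zero, Matrix.cons_val_one,
        smul_eq_mul]
      field_simp
      linear_combination e1

/-- If `det Q < 0`, the plane orthogonal to `Q` has a basis of matrices with zero determinant. -/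
theorem exists_isotropic_basis {Q : Mat} (hQ : Q.IsSymm) (hdet : Q.det < 0) :
    ∃ (N M : Mat) (k : ℝ), N.IsSymm ∧ M.IsSymm ∧ 0 < k ∧ N 0 0 * N 1 1 - N 0 1 ^ 2 = 0 ∧
      M 0 0 * M 1 1 - M 0 1 ^ 2 = 0 ∧
      N 0 0 * M 1 1 + N 1 1 * M 0 0 - 2 * (N 0 1 * M 0 1) = k ∧
      ∀ A : Mat, A.IsSymm → Q 0 0 * A 0 0 + 2 * Q 0 1 * A 0 1 + Q 1 1 * A 1 1 = 0 →
        ∃ s t : ℝ, A = s • N + t • M := by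
  rw [det_eq_of_isSymm hQ] at hdet
  set a := Q 0 0
  set b := Q 0 1
  set c := Q 1 1
  by_cases ha : a = 0
  · rw [ha] at hdet ⊢
    have hb : b ≠ 0 := by rintro h; simp [h] at hdet
    refine ⟨!![1, 0; 0, 0], !![c ^ 2, -(2 * b * c); -(2 * b * c), 4 * b ^ 2], 4 * b ^ 2,
      isSymm_fin_two _ _ _, isSymm_fin_two _ _ _, by positivity, by simp, by simp; ring, by simp,
      fun A hA h => ?_⟩
    refine ⟨A 0 0 - c ^ 2 * (A 1 1 / (4 * b ^ 2)), A 1 1 / (4 * b ^ 2), ?_⟩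
    refine ext_of_isSymm hA (((isSymm_fin_two _ _ _).smul _).add ((isSymm_fin_two _ _ _).smul _))
      ?_ ?_ ?_
    · simp; ring
    · simp
      field_simp
      linear_combination 2 * h
    · simp
      field_simp
  · obtain ⟨d, hd0, hd⟩ : ∃ d : ℝ, 0 < d ∧ d ^ 2 = b ^ 2 - a * c :=
      ⟨Real.sqrt (b ^ 2 - a * c), Real.sqrt_pos.2 (by linarith), Real.sq_sqrt (by linarith)⟩
    -- The matrices `v vᵀ` for the two null vectors `(d - b, a)` and `(-(b + d), a)` of the
    -- quadratic form of `Q`; `k` is the square of the determinant of this pair.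
    refine ⟨!![(d - b) ^ 2, a * (d - b); a * (d - b), a ^ 2],
      !![(b + d) ^ 2, -(a * (b + d)); -(a * (b + d)), a ^ 2], 4 * a ^ 2 * d ^ 2,
      isSymm_fin_two _ _ _, isSymm_fin_two _ _ _, by positivity, by simp; ring, by simp; ring,
      by simp; ring, fun A hA h => ?_⟩
    refine ⟨(A 1 1 / a ^ 2 + (a * A 0 1 + b * A 1 1) / (a ^ 2 * d)) / 2,
      (A 1 1 / a ^ 2 - (a * A 0 1 + b * A 1 1) / (a ^ 2 * d)) / 2, ?_⟩
    refine ext_of_isSymm hA (((isSymm_fin_two _ _ _).smul _).add ((isSymm_fin_two _ _ _).smul _))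
      ?_ ?_ ?_
    · simp
      field_simp
      linear_combination 2 * d * a * h - 2 * d * A 1 1 * hd
    · simp
      field_simp
      ring
    · simp
      field_simp
      ring

/-- Affine coordinates on the plane through `O` spanned by `N` and `M`. -/
def planeMap (O N M : Mat) (p : ℝ × ℝ) : Mat := O + (p.1 • N + p.2 • M)

theorem det_planeMap_sub {O N M : Mat} {k : ℝ} (hN : N.IsSymm) (hM : M.IsSymm)
    (hN0 : N 0 0 * N 1 1 - N 0 1 ^ 2 = 0) (hM0 : M 0 0 * M 1 1 - M 0 1 ^ 2 = 0)
    (hk : N 0 0 * M 1 1 + N 1 1 * M 0 0 - 2 * (N 0 1 * M 0 1) = k) (p q : ℝ × ℝ) :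
    (planeMap O N M p - planeMap O N M q).det = k * ((p.1 - q.1) * (p.2 - q.2)) := by
  rw [show planeMap O N M p - planeMap O N M q = (p.1 - q.1) • N + (p.2 - q.2) • M by
    simp only [planeMap]; module, det_eq_of_isSymm ((hN.smul _).add (hM.smul _))]
  simp only [Matrix.add_apply, Matrix.smul_apply, smul_eq_mul]
  linear_combination (p.1 - q.1) ^ 2 * hN0 + (p.2 - q.2) ^ 2 * hM0
    + (p.1 - q.1) * (p.2 - q.2) * hk

/-- A vanishing determinant of the difference only yields one common coordinate, so both points are
compared with two auxiliary points, which together fix both coordinates. -/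
theorem planeMap_injective {O N M : Mat} {k : ℝ} (hk : 0 < k)
    (hdet : ∀ p q, (planeMap O N M p - planeMap O N M q).det = k * ((p.1 - q.1) * (p.2 - q.2))) :
    Function.Injective (planeMap O N M) := by
  intro p q hpq
  have h1 := hdet p (q.1 - 1, q.2 - 1)
  have h2 := hdet q (q.1 - 1, q.2 - 1)
  have h3 := hdet p (q.1 - 1, q.2 + 1)
  have h4 := hdet q (q.1 - 1, q.2 + 1)
  rw [hpq, h2] at h1
  rw [hpq, h4] at h3
  have e1 := mul_left_cancel₀ hk.ne' h1
  have e3 := mul_left_cancel₀ hk.ne' h3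
  simp only at e1 e3
  have f1 : p.1 = q.1 := by linarith
  have f2 : p.2 = q.2 := by rw [f1] at e1; linarith
  exact Prod.ext f1 f2

theorem planeMap_segment (O N M : Mat) (p q : ℝ × ℝ) (t : ℝ) :
    planeMap O N M (t • p + (1 - t) • q)
      = t • planeMap O N M p + (1 - t) • planeMap O N M q := by
  simp only [planeMap, Prod.fst_add, Prod.snd_add, Prod.smul_fst, Prod.smul_snd, smul_eq_mul]
  module

/-- No three distinct points of the set are collinear. -/
def NoThreeCollinear (U : Set Mat) : Prop :=
  ∀ X ∈ U, ∀ Y ∈ U, ∀ Z ∈ U, X ≠ Y → Y ≠ Z → X ≠ Z → ¬ Collinear ℝ ({X, Y, Z} : Set Mat)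

theorem collinear_of_smul_add {P R X Y Z : Mat} {a b c : ℝ} (hX : X = a • R + P)
    (hY : Y = b • R + P) (hZ : Z = c • R + P) : Collinear ℝ ({X, Y, Z} : Set Mat) := by
  rw [collinear_iff_exists_forall_eq_smul_vadd]
  refine ⟨P, R, ?_⟩
  rintro p (rfl | rfl | rfl)
  · exact ⟨a, hX⟩
  · exact ⟨b, hY⟩
  · exact ⟨c, hZ⟩

theorem noThreeAxial_preimage {U : Set Mat} (hU : NoThreeCollinear U) {O N M : Mat}
    (hinj : Function.Injective (planeMap O N M)) : NoThreeAxial (planeMap O N M ⁻¹' U) := by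
  constructor
  · intro p hp q hq r hr hpq hqr
    by_contra! h
    refine hU _ hp _ hq _ hr (hinj.ne h.1) (hinj.ne h.2.1) (hinj.ne h.2.2) ?_
    refine collinear_of_smul_add (R := N) (P := O + p.2 • M) (a := p.1) (b := q.1) (c := r.1)
      ?_ ?_ ?_
    · simp only [planeMap]; abel
    · simp only [planeMap, hpq]; abel
    · simp only [planeMap, hpq, hqr]; abel
  · intro p hp q hq r hr hpq hqr
    by_contra! h
    have hs := Prod.swap_injective (α := ℝ) (β := ℝ)
    refine hU _ hp _ hq _ hr (hinj.ne (hs.ne h.1)) (hinj.ne (hs.ne h.2.1))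
      (hinj.ne (hs.ne h.2.2)) ?_
    refine collinear_of_smul_add (R := M) (P := O + p.2 • N) (a := p.1) (b := q.1) (c := r.1)
      ?_ ?_ ?_
    · simp only [planeMap, Prod.fst_swap, Prod.snd_swap]; abel
    · simp only [planeMap, Prod.fst_swap, Prod.snd_swap, hpq]; abel
    · simp only [planeMap, Prod.fst_swap, Prod.snd_swap, hpq, hqr]; abel

/-! ### Crosses -/

theorem eq_or_eq_of_mem_segment {U : Set Mat} (hU : NoThreeCollinear U) {X V W : Mat}
    (hX : X ∈ U) (hV : V ∈ U) (hW : W ∈ U) (hVW : V ≠ W) (h : X ∈ segment ℝ V W) :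
    X = V ∨ X = W := by
  by_contra! hne
  exact hU V hV X hX W hW hne.1.symm hne.2 hVW (mem_segment_iff_wbtw.1 h).collinear

theorem isClosed_segment_mat (V W : Mat) : IsClosed (segment ℝ V W) := by
  rw [segment_eq_image ℝ V W]
  refine (isCompact_Icc.image ?_).isClosed
  fun_prop

/-- Without three collinear wells, a well on a segment is one of its ends, so the four wells are the
four ends and these are distinct. Two closed segments with connected union must meet. -/
theorem IsCrossBlock.exists_crossing {B U : Set Mat} (hB : IsCrossBlock B)
    (hU : NoThreeCollinear U) (hBU : B ⊆ U) :
    ∃ V₁ V₂ W₁ W₂ : Mat, B = {V₁, V₂, W₁, W₂} ∧ V₁ ≠ V₂ ∧ W₁ ≠ W₂ ∧ V₁ ≠ W₁ ∧ V₁ ≠ W₂ ∧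
      V₂ ≠ W₁ ∧ V₂ ≠ W₂ ∧ RankOneCompatible V₁ V₂ ∧ RankOneCompatible W₁ W₂ ∧
      ∃ s r : ℝ, 0 ≤ s ∧ s ≤ 1 ∧ 0 ≤ r ∧ r ≤ 1 ∧
        V₁ + s • (V₂ - V₁) = W₁ + r • (W₂ - W₁) := by
  obtain ⟨hcard, V₁, V₂, W₁, W₂, hV₁, hV₂, hW₁, hW₂, hV, hW, -, hrV, hrW, hconn, hsub⟩ := hB
  have hB4 : B ⊆ {V₁, V₂, W₁, W₂} := by
    intro X hX
    rcases hsub hX with h | h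
    · rcases eq_or_eq_of_mem_segment hU (hBU hX) (hBU hV₁) (hBU hV₂) hV h with rfl | rfl <;> simp
    · rcases eq_or_eq_of_mem_segment hU (hBU hX) (hBU hW₁) (hBU hW₂) hW h with rfl | rfl <;> simp
  have hcard3 : ∀ X Y Z : Mat, ¬ B ⊆ {X, Y, Z} := by
    intro X Y Z h
    have h1 := Set.ncard_le_ncard h
    have h2 := Set.ncard_insert_le X {Y, Z}
    have h3 := Set.ncard_insert_le Y {Z}
    rw [Set.ncard_singleton] at h3
    omega
  refine ⟨V₁, V₂, W₁, W₂, ?_, hV, hW, ?_, ?_, ?_, ?_, hrV, hrW, ?_⟩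
  · refine hB4.antisymm ?_
    rintro X (rfl | rfl | rfl | rfl) <;> assumption
  · rintro rfl
    exact hcard3 V₁ V₂ W₂ (hB4.trans (by intro X; simp; tauto))
  · rintro rfl
    exact hcard3 V₁ V₂ W₁ (hB4.trans (by intro X; simp; tauto))
  · rintro rfl
    exact hcard3 V₁ V₂ W₂ (hB4.trans (by intro X; simp))
  · rintro rfl
    exact hcard3 V₁ V₂ W₁ (hB4.trans (by intro X; simp; tauto))
  · obtain ⟨X, -, hX1, hX2⟩ := isPreconnected_closed_iff.1 hconn.isPreconnected _ _
      (isClosed_segment_mat V₁ V₂) (isClosed_segment_mat W₁ W₂) Subset.rfl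
      ⟨V₁, Or.inl (left_mem_segment ℝ _ _), left_mem_segment ℝ _ _⟩
      ⟨W₁, Or.inr (left_mem_segment ℝ _ _), left_mem_segment ℝ _ _⟩
    rw [segment_eq_image' ℝ] at hX1 hX2
    obtain ⟨s, hs, rfl⟩ := hX1
    obtain ⟨r, hr, hrs⟩ := hX2
    exact ⟨s, r, hs.1, hs.2, hr.1, hr.2, hrs.symm⟩

theorem NoThreeCollinear.mono {U V : Set Mat} (h : NoThreeCollinear V) (hUV : U ⊆ V) :
    NoThreeCollinear U :=
  fun X hX Y hY Z hZ => h X (hUV hX) Y (hUV hY) Z (hUV hZ)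

theorem sub_orthogonal {Q A B : Mat} (hQ : Q.IsSymm) (hA : A.IsSymm) (hB : B.IsSymm) {δ : ℝ}
    (hAδ : ∑ i, ∑ j, Q i j * A i j = δ) (hBδ : ∑ i, ∑ j, Q i j * B i j = δ) :
    Q 0 0 * (A - B) 0 0 + 2 * Q 0 1 * (A - B) 0 1 + Q 1 1 * (A - B) 1 1 = 0 := by
  rw [sum_mul_eq hQ hA] at hAδ
  rw [sum_mul_eq hQ hB] at hBδ
  simp only [Matrix.sub_apply]
  linarith

/-- The plane of a basic configuration contains incompatible directions. -/
theorem det_neg_of_isBasicBlock {Q : Mat} {δ : ℝ} (hQ : Q.IsSymm) (hQ0 : Q ≠ 0) {B : Set Mat}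
    (hsymm : ∀ M ∈ B, M.IsSymm) (hplane : ∀ M ∈ B, ∑ i, ∑ j, Q i j * M i j = δ)
    (hcol : NoThreeCollinear B) (hB : IsBasicBlock B) : Q.det < 0 := by
  by_contra! hdet
  obtain ⟨R, hR⟩ := exists_isotropic_line hQ hQ0 hdet
  have hR' : ∀ X ∈ B, ∀ Y ∈ B, (X - Y).det ≤ 0 ∧ ((X - Y).det = 0 → ∃ s : ℝ, X - Y = s • R) :=
    fun X hX Y hY => hR _ ((hsymm X hX).sub (hsymm Y hY))
      (sub_orthogonal hQ (hsymm X hX) (hsymm Y hY) (hplane X hX) (hplane Y hY))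
  -- A flag has an incompatible pair, hence a positive determinant. A cross with a single rank-one
  -- direction would have collinear wells, because its bars meet.
  rcases hB with ⟨X, Y, Z, rfl, -, -, hYZ⟩ | hB
  · exact hYZ ((compatible_iff (hsymm Y (by simp)) (hsymm Z (by simp))).2
      (hR' Y (by simp) Z (by simp)).1)
  · obtain ⟨V₁, V₂, W₁, W₂, rfl, hV, -, h11, -, h21, -, hrV, hrW, s, r, -, -, -, -, hO⟩ :=
      hB.exists_crossing hcol Subset.rfl
    obtain ⟨α, hα⟩ := (hR' V₂ (by simp) V₁ (by simp)).2
      (by rw [← neg_sub, Matrix.det_neg, (rankOneCompatible_iff _ _).1 hrV, mul_zero])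
    obtain ⟨β, hβ⟩ := (hR' W₂ (by simp) W₁ (by simp)).2
      (by rw [← neg_sub, Matrix.det_neg, (rankOneCompatible_iff _ _).1 hrW, mul_zero])
    refine hcol V₁ (by simp) V₂ (by simp) W₁ (by simp) hV h21 h11 (collinear_of_smul_add (R := R)
      (P := V₁) (a := 0) (b := α) (c := s * α - r * β) (by simp) (by rw [← hα]; abel) ?_)
    rw [hα, hβ] at hO
    have : W₁ = V₁ + s • α • R - r • β • R := by rw [hO]; abel
    rw [this]
    module

/-! ### Transfer of configurations and hulls to isotropic coordinates -/

section Coordinates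

variable {O N M : Mat} {k : ℝ}

theorem isSymm_planeMap (hO : O.IsSymm) (hN : N.IsSymm) (hM : M.IsSymm) (p : ℝ × ℝ) :
    (planeMap O N M p).IsSymm :=
  hO.add ((hN.smul _).add (hM.smul _))

theorem compatible_planeMap_iff (hk : 0 < k) (hsymm : ∀ p, (planeMap O N M p).IsSymm)
    (hdet : ∀ p q, (planeMap O N M p - planeMap O N M q).det = k * ((p.1 - q.1) * (p.2 - q.2)))
    (p q : ℝ × ℝ) :
    Compatible (planeMap O N M p) (planeMap O N M q) ↔ (p.1 - q.1) * (p.2 - q.2) ≤ 0 := by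
  rw [compatible_iff (hsymm p) (hsymm q), hdet]
  exact ⟨fun h => nonpos_of_mul_nonpos_right h hk, fun h => mul_nonpos_of_nonneg_of_nonpos hk.le h⟩

theorem rankOneCompatible_planeMap_iff (hk : 0 < k)
    (hdet : ∀ p q, (planeMap O N M p - planeMap O N M q).det = k * ((p.1 - q.1) * (p.2 - q.2)))
    (p q : ℝ × ℝ) :
    RankOneCompatible (planeMap O N M p) (planeMap O N M q)
      ↔ (p.1 - q.1) * (p.2 - q.2) = 0 := by
  rw [rankOneCompatible_iff, hdet, mul_eq_zero, or_iff_right hk.ne']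

theorem isPoleBlock_preimage (hk : 0 < k) (hsymm : ∀ p, (planeMap O N M p).IsSymm)
    (hdet : ∀ p q, (planeMap O N M p - planeMap O N M q).det = k * ((p.1 - q.1) * (p.2 - q.2)))
    {B : Set Mat} (hsurj : ∀ A ∈ B, ∃ p, planeMap O N M p = A) (hcol : NoThreeCollinear B)
    (hB : IsBasicBlock B) : IsPoleBlock (planeMap O N M ⁻¹' B) := by
  have hinj := planeMap_injective hk hdet
  have hcomp := compatible_planeMap_iff hk hsymm hdet
  have hrank := rankOneCompatible_planeMap_iff hk hdet
  rcases hB with ⟨X, Y, Z, rfl, ⟨hXY, hXY'⟩, hXZ, hYZ⟩ | hB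
  · obtain ⟨X, rfl⟩ := hsurj X (by simp)
    obtain ⟨Y, rfl⟩ := hsurj Y (by simp)
    obtain ⟨Z, rfl⟩ := hsurj Z (by simp)
    rw [hcomp] at hXY hYZ
    rw [hrank] at hXY' hXZ
    have e : planeMap O N M ⁻¹' {planeMap O N M X, planeMap O N M Y, planeMap O N M Z}
        = {X, Y, Z} := by
      ext p
      simp [hinj.eq_iff]
    rw [e]
    exact isPoleBlock_flag (lt_of_le_of_ne hXY hXY') hXZ (not_le.1 hYZ)
  · obtain ⟨V₁, V₂, W₁, W₂, rfl, hV, hW, h11, h12, h21, h22, hrV, hrW, s, r, hs0, hs1, hr0, hr1,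
      hO⟩ := hB.exists_crossing hcol Subset.rfl
    have hS := noThreeAxial_preimage hcol hinj
    obtain ⟨v₁, rfl⟩ := hsurj V₁ (by simp)
    obtain ⟨v₂, rfl⟩ := hsurj V₂ (by simp)
    obtain ⟨w₁, rfl⟩ := hsurj W₁ (by simp)
    obtain ⟨w₂, rfl⟩ := hsurj W₂ (by simp)
    have e : planeMap O N M ⁻¹' {planeMap O N M v₁, planeMap O N M v₂, planeMap O N M w₁,
        planeMap O N M w₂} = {v₁, v₂, w₁, w₂} := by
      ext p
      simp [hinj.eq_iff]
    rw [e] at hS ⊢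
    rw [hrank] at hrV hrW
    refine isPoleBlock_cross hS (ne_of_apply_ne _ hV) (ne_of_apply_ne _ hW) (ne_of_apply_ne _ h11)
      (ne_of_apply_ne _ h12) (ne_of_apply_ne _ h21) (ne_of_apply_ne _ h22) hrV hrW hs0 hs1 hr0 hr1
      (hinj ?_)
    have hseg : ∀ (p q : ℝ × ℝ) (t : ℝ), planeMap O N M (p + t • (q - p))
        = planeMap O N M p + t • (planeMap O N M q - planeMap O N M p) := by
      intro p q t
      rw [show p + t • (q - p) = t • q + (1 - t) • p by module, planeMap_segment]
      module
    rw [hseg, hseg, hO]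

theorem staircase_preimage (hk : 0 < k) (hsymm : ∀ p, (planeMap O N M p).IsSymm)
    (hdet : ∀ p q, (planeMap O N M p - planeMap O N M q).det = k * ((p.1 - q.1) * (p.2 - q.2)))
    {U : Set Mat} (hfin : U.Finite) (hsurj : ∀ A ∈ U, ∃ p, planeMap O N M p = A)
    (hU : IsBasicConfiguration U) : Staircase (planeMap O N M ⁻¹' U) := by
  obtain ⟨hcol, n, B, rfl, hB, hchain⟩ := hU
  have hcol' : NoThreeCollinear (⋃ i ∈ Finset.range (n + 1), B i) := hcol
  have hsub : ∀ i ≤ n, B i ⊆ ⋃ i ∈ Finset.range (n + 1), B i := fun i hi =>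
    subset_biUnion_of_mem (u := B)
      (Finset.mem_range.2 (by omega) : i ∈ Finset.range (n + 1))
  have hinj := planeMap_injective hk hdet
  have hS := noThreeAxial_preimage hcol' hinj
  simp only [preimage_iUnion] at hS ⊢
  refine staircase_iUnion_poleBlock (fun i hi => ?_) (fun i hi => ?_) (fun i hi => ?_) hS
  · exact isPoleBlock_preimage hk hsymm hdet (fun A hA => hsurj A (hsub i hi hA))
      (hcol'.mono (hsub i hi)) (hB i hi)
  · exact (hfin.subset (hsub i hi)).preimage hinj.injOn
  · obtain ⟨V, W, hVW, hc, hr⟩ := hchain i hi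
    have hV : V ∈ B i ∩ B (i + 1) := by rw [hVW]; simp
    have hW : W ∈ B i ∩ B (i + 1) := by rw [hVW]; simp
    obtain ⟨v, rfl⟩ := hsurj V (hsub i hi.le hV.1)
    obtain ⟨w, rfl⟩ := hsurj W (hsub i hi.le hW.1)
    rw [compatible_planeMap_iff hk hsymm hdet] at hc
    rw [rankOneCompatible_planeMap_iff hk hdet] at hr
    refine ⟨v, w, hV.1, hW.1, hV.2, hW.2, ?_⟩
    have := lt_of_le_of_ne hc hr
    linarith

theorem lamClosed_preimage (hk : 0 < k) (hsymm : ∀ p, (planeMap O N M p).IsSymm)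
    (hdet : ∀ p q, (planeMap O N M p - planeMap O N M q).det = k * ((p.1 - q.1) * (p.2 - q.2)))
    (U : Set Mat) : LamClosed (planeMap O N M ⁻¹' symLaminationHull U) := by
  intro p hp q hq hpq t ht0 ht1
  rw [mem_preimage, planeMap_segment]
  exact symLaminationHull_segment hp hq ((compatible_planeMap_iff hk hsymm hdet p q).2 hpq) ht0 ht1

theorem inPolyHull_preimage (hO : O.IsSymm) (hN : N.IsSymm) (hM : M.IsSymm) (hk : 0 < k)
    (hN0 : N 0 0 * N 1 1 - N 0 1 ^ 2 = 0) (hM0 : M 0 0 * M 1 1 - M 0 1 ^ 2 = 0)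
    (hNM : N 0 0 * M 1 1 + N 1 1 * M 0 0 - 2 * (N 0 1 * M 0 1) = k)
    {U : Set Mat} (hne : U.Nonempty) (hsurj : ∀ A ∈ U, ∃ p, planeMap O N M p = A) {z : ℝ × ℝ}
    (hz : planeMap O N M z ∈ symQuasiconvexHull U) : InPolyHull (planeMap O N M ⁻¹' U) z := by
  intro c α β γ hc hS
  -- `p`, `q`, `r` are the coefficients of a linear form with value `α` on `N` and `β` on `M`, built
  -- from the polar form of the determinant, for which `N` and `M` are isotropic and pair to `k`.
  obtain ⟨p, hp⟩ : ∃ p, p = (α * M 1 1 + β * N 1 1) / k := ⟨_, rfl⟩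
  obtain ⟨q, hq⟩ : ∃ q, q = -2 * (α * M 0 1 + β * N 0 1) / k := ⟨_, rfl⟩
  obtain ⟨r, hr⟩ : ∃ r, r = (α * M 0 0 + β * N 0 0) / k := ⟨_, rfl⟩
  have hpqN : p * N 0 0 + q * N 0 1 + r * N 1 1 = α := by
    rw [hp, hq, hr]
    field_simp
    linear_combination α * hNM + 2 * β * hN0
  have hpqM : p * M 0 0 + q * M 0 1 + r * M 1 1 = β := by
    rw [hp, hq, hr]
    field_simp
    linear_combination β * hNM + 2 * α * hM0
  -- The terms in `O` complete `-(c / k) det A` to `-(c / k) det (A - O)`, which is `-c` times the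
  -- product of the coordinates.
  have key : ∀ u : ℝ × ℝ,
      -(c / k) * (planeMap O N M u).det + ((p + c / k * O 1 1) * planeMap O N M u 0 0
        + (q - 2 * (c / k) * O 0 1) * planeMap O N M u 0 1
        + (r + c / k * O 0 0) * planeMap O N M u 1 1)
        + (γ - c / k * (O 0 0 * O 1 1 - O 0 1 ^ 2) - (p * O 0 0 + q * O 0 1 + r * O 1 1))
      = -c * (u.1 * u.2) + α * u.1 + β * u.2 + γ := by
    intro u
    rw [det_eq_of_isSymm (isSymm_planeMap hO hN hM u)]
    simp only [planeMap, Matrix.add_apply, Matrix.smul_apply, smul_eq_mul]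
    have hck : c / k * k = c := div_mul_cancel₀ c hk.ne'
    linear_combination u.1 * hpqN + u.2 * hpqM - (c / k) * u.1 ^ 2 * hN0
      - (c / k) * u.2 ^ 2 * hM0 - (c / k) * u.1 * u.2 * hNM - u.1 * u.2 * hck
  rw [← key]
  refine le_zero_of_mem_symQuasiconvexHull hne hz (div_nonneg hc hk.le) _ _ _ _ fun A hA => ?_
  obtain ⟨u, rfl⟩ := hsurj A hA
  rw [key]
  exact hS u hA

end Coordinates

/-! ### The hull stays in the plane; conclusion -/

theorem sum_mul_eq_of_mem_symQuasiconvexHull {U : Set Mat} (hne : U.Nonempty)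
    (hsymm : ∀ M ∈ U, M.IsSymm) {Q : Mat} (hQ : Q.IsSymm) {δ : ℝ}
    (hU : ∀ M ∈ U, ∑ i, ∑ j, Q i j * M i j = δ) {A : Mat} (hA : A ∈ symQuasiconvexHull U) :
    ∑ i, ∑ j, Q i j * A i j = δ := by
  have hU' : ∀ M ∈ U, Q 0 0 * M 0 0 + 2 * Q 0 1 * M 0 1 + Q 1 1 * M 1 1 = δ := fun M hM => by
    rw [← sum_mul_eq hQ (hsymm M hM), hU M hM]
  rw [sum_mul_eq hQ hA.1]
  -- With `c = 0` the linear form and its negative are both admissible, so the equality survives in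
  -- the hull.
  have h1 := le_zero_of_mem_symQuasiconvexHull hne hA le_rfl (Q 0 0) (2 * Q 0 1) (Q 1 1) (-δ)
    fun M hM => by linarith [hU' M hM]
  have h2 := le_zero_of_mem_symQuasiconvexHull hne hA le_rfl (-Q 0 0) (-(2 * Q 0 1)) (-Q 1 1) δ
    fun M hM => by linarith [hU' M hM]
  linarith

theorem IsBasicBlock.nonempty {B : Set Mat} (hB : IsBasicBlock B) : B.Nonempty := by
  rcases hB with ⟨X, Y, Z, rfl, -⟩ | ⟨-, V, -, -, -, hV, -⟩
  · exact ⟨X, by simp⟩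
  · exact ⟨V, hV⟩

end Wells

theorem theorem3 (U : Set Wells.Mat)
    (hsymm : ∀ M ∈ U, M.IsSymm)
    (hfin : U.Finite)
    (hcop : Wells.IsCoplanar U)
    (hbasic : Wells.IsBasicConfiguration U) :
    Wells.symLaminationHull U = Wells.symQuasiconvexHull U := by
  refine (Wells.symLaminationHull_subset_symQuasiconvexHull hsymm hfin).antisymm fun A hA => ?_
  obtain ⟨Q, δ, hQ, hQ0, hplane⟩ := hcop
  obtain ⟨hcol, n, B, hU, hB, -⟩ := id hbasic
  have hcol' : Wells.NoThreeCollinear U := hcol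
  have hB0 : B 0 ⊆ U := by
    rw [hU]
    exact subset_biUnion_of_mem (u := B)
      (Finset.mem_range.2 (by omega) : 0 ∈ Finset.range (n + 1))
  have hblock := hB 0 (Nat.zero_le n)
  have hdetQ : Q.det < 0 := Wells.det_neg_of_isBasicBlock hQ hQ0 (fun M hM => hsymm M (hB0 hM))
    (fun M hM => hplane M (hB0 hM)) (hcol'.mono hB0) hblock
  have hne : U.Nonempty := hblock.nonempty.mono hB0
  obtain ⟨O, hOU⟩ := id hne
  have hO := hsymm O hOU
  obtain ⟨N, M, k, hN, hM, hk, hN0, hM0, hNM, hspan⟩ := Wells.exists_isotropic_basis hQ hdetQ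
  have hsymm' := Wells.isSymm_planeMap hO hN hM
  have hdet := Wells.det_planeMap_sub (O := O) hN hM hN0 hM0 hNM
  have hsurj : ∀ X : Wells.Mat, X.IsSymm → ∑ i, ∑ j, Q i j * X i j = δ →
      ∃ p, Wells.planeMap O N M p = X := by
    intro X hX hXδ
    obtain ⟨s, t, hst⟩ := hspan (X - O) (hX.sub hO)
      (Wells.sub_orthogonal hQ hX hO hXδ (hplane O hOU))
    exact ⟨(s, t), by simp only [Wells.planeMap]; rw [← hst]; abel⟩
  have hsurjU : ∀ X ∈ U, ∃ p, Wells.planeMap O N M p = X := fun X hX =>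
    hsurj X (hsymm X hX) (hplane X hX)
  obtain ⟨z, rfl⟩ := hsurj A hA.1
    (Wells.sum_mul_eq_of_mem_symQuasiconvexHull hne hsymm hQ hplane hA)
  obtain ⟨x, y, a, b, c, d, hS⟩ := Wells.staircase_preimage hk hsymm' hdet hfin hsurjU hbasic
  -- Applied with `T` the preimage of the lamination hull, which is closed under admissible segments
  -- and contains the wells.
  exact hS.mem_of_inPolyHull
    (Wells.inPolyHull_preimage hO hN hM hk hN0 hM0 hNM hne hsurjU hA)
    (Wells.lamClosed_preimage hk hsymm' hdet U)
    (preimage_mono (Wells.subset_symLaminationHull U))
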